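/- Let $p$ be a prime, let $K/\mathbb{Q}_p$ be a finite field extension, let $\mathcal{O}$ be its valuation ring (the integral closure of $\mathbb{Z}_p$ in $K$), and let $\pi$ be a uniformiser. Let $\Delta$ be the Bruhat–Tits building of $SL_3(K)$, the $\widetilde{A}_2$ building: its vertices are the classes $[L]$, modulo scaling by $K^\times$, of the full rank $\mathcal{O}$-lattices $L$ in $K^3$; two distinct vertices $[L]$ and $[M]$ are joined by an edge if $L\supseteq\alpha M\supseteq\pi L$ for some $\alpha\in K^\times$; its chambers are the sets of three pairwise joined vertices. Two distinct chambers are adjacent if they share an edge, and the distance $d(D,E)$ between two chambers is the length of a minimal gallery (sequence of successively adjacent chambers) from $D$ to $E$. Let $e_1,e_2,e_3$ be the standard basis of $K^3$, and let $C$ be the hyperspecial chamber, with vertices $[\langle e_1,e_2,e_3\rangle]$, $[\langle e_1,e_2,\pi e_3\rangle]$ and $[\langle e_1,\pi e_2,\pi e_3\rangle]$. For $n\geq 0$ let $\Delta_n$ be the set of all vertices that lie in some chamber $D$ with $d(C,D)\leq n$. For $n>0$, a vertex $v\in\Delta_n\setminus\Delta_{n-1}$ is called a peak of $\Delta_n$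 if there is a unique chamber $D_v$ (the summit at $v$) that contains $v$ and satisfies $d(D_v,C)=n$, if its base $D_v\setminus\{v\}$ is contained in $\Delta_{n-1}$, and if the vertices of the base are the only vertices in $\Delta_{n-1}$ that are joined to $v$ by an edge. Then for every $n>0$: (1) Every vertex $v\in\Delta_n\setminus\Delta_{n-1}$ is a peak of $\Delta_n$. (2) If $u,v\in\Delta_n\setminus\Delta_{n-1}$ are joined by an edge $e$, then there is a unique chamber $E$ with $d(E,C)=n+1$ that contains $e$ and is adjacent to both summits $D_u$ and $D_v$. -/

import Mathlib

open scoped Pointwise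

/-! ### Chambers, galleries, the regions `Δ_n` and peaks in a two-dimensional flag complex

A two-dimensional flag complex is given by its graph of vertices and edges; its chambers
(maximal simplices) are the complete subgraphs on three vertices. -/

namespace Building

variable {V : Type*}

/-- A chamber of the flag complex of `G`: three pairwise joined vertices. -/
def Chamber (G : SimpleGraph V) : Type _ := {s : Finset V // G.IsNClique 3 s}

namespace Chamber

variable {G : SimpleGraph V}

/-- The set of vertices of a chamber. -/
def verts (D : Chamber G) : Set V := {v | v ∈ D.1}

/-- Two chambers are adjacent if they are distinct and share a face of codimension one,
that is, an edge. -/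
def graph (G : SimpleGraph V) : SimpleGraph (Chamber G) where
  Adj D E := D ≠ E ∧ ∃ F : Finset V, F.card = 2 ∧ F ⊆ D.1 ∧ F ⊆ E.1
  symm := ⟨fun _ _ h => ⟨h.1.symm, h.2.imp fun _ hF => ⟨hF.1, hF.2.2, hF.2.1⟩⟩⟩
  loopless := ⟨fun _ h => h.1 rfl⟩

/-- The distance between two chambers: the length of a minimal gallery joining them
(`⊤` if there is none). -/
noncomputable def dist (D E : Chamber G) : ℕ∞ := (graph G).edist D E

end Chamber

variable {G : SimpleGraph V}

/-- The region `Δ_n` around the chamber `C`: the set of all vertices that lie in a chamber at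
distance at most `n` from `C`. -/
def region (C : Chamber G) (n : ℕ) : Set V :=
  {v | ∃ D : Chamber G, v ∈ D.verts ∧ C.dist D ≤ n}

/-- For `0 < n` and a vertex `v` of `Δ_n ∖ Δ_{n-1}`: the chamber `D` is the summit of `Δ_n`
at `v`, and `v` is a peak of `Δ_n`. That is, `D` is the unique chamber containing `v` at
distance `n` from `C`, its base `D ∖ {v}` lies in `Δ_{n-1}`, and the vertices of the base are
exactly the vertices of `Δ_{n-1}` that are joined to `v` by an edge. -/
structure IsSummit (C : Chamber G) (n : ℕ) (v : V) (D : Chamber G) : Prop where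
  mem : v ∈ D.verts
  dist_eq : C.dist D = n
  unique : ∀ D' : Chamber G, v ∈ D'.verts → C.dist D' = n → D' = D
  base_subset : D.verts \ {v} ⊆ region C (n - 1)
  neighbours : {w | w ∈ region C (n - 1) ∧ G.Adj v w} = D.verts \ {v}

/-- For `0 < n`: the vertex `v` of `Δ_n ∖ Δ_{n-1}` is a peak of `Δ_n`. -/
def IsPeak (C : Chamber G) (n : ℕ) (v : V) : Prop :=
  v ∈ region C n \ region C (n - 1) ∧ ∃ D : Chamber G, IsSummit C n v D

end Building

/-! ### The `Ã₂` building of `SL₃(K)`, through homothety classes of lattices -/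

namespace A2Building

variable (O K : Type*) [CommRing O] [Field K] [Algebra O K]

/-- Full rank `O`-lattices in `K³`. -/
def Lattice : Type _ := {L : Submodule O (Fin 3 → K) // Submodule.IsLattice K L}

/-- Two lattices are equivalent if one is a multiple of the other by a nonzero scalar of `K`. -/
def homothety : Setoid (Lattice O K) where
  r L M := ∃ α : Kˣ, α • L.1 = M.1
  iseqv :=
    { refl := fun L => ⟨1, one_smul _ _⟩
      symm := by
        rintro L M ⟨α, h⟩
        exact ⟨α⁻¹, by rw [← h, smul_smul, inv_mul_cancel, one_smul]⟩
      trans := by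
        rintro L M N ⟨α, h⟩ ⟨β, h'⟩
        exact ⟨β * α, by rw [← h', ← h, smul_smul]⟩ }

/-- The vertices of the building: full rank `O`-lattices in `K³` modulo scaling. -/
def Vertex : Type _ := Quotient (homothety O K)

variable {O K}

/-- The vertex given by a lattice. -/
def Vertex.mk (L : Lattice O K) : Vertex O K := Quotient.mk (homothety O K) L

theorem Vertex.mk_eq_mk {L M : Lattice O K} :
    Vertex.mk L = Vertex.mk M ↔ ∃ α : Kˣ, α • L.1 = M.1 :=
  ⟨fun h => Quotient.exact h, fun h => Quotient.sound h⟩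

/-- The element `π` of `O`, as a nonzero scalar of `K`. -/
def unif [FaithfulSMul O K] {π : O} (hπ : Irreducible π) : Kˣ :=
  Units.mk0 (algebraMap O K π)
    ((map_ne_zero_iff _ (FaithfulSMul.algebraMap_injective O K)).2 hπ.ne_zero)

theorem unif_smul [FaithfulSMul O K] {π : O} (hπ : Irreducible π)
    (L : Submodule O (Fin 3 → K)) : (unif hπ : Kˣ) • L = π • L := by
  ext x
  rw [Units.smul_def, Submodule.mem_smul_pointwise_iff_exists,
    Submodule.mem_smul_pointwise_iff_exists]
  refine exists_congr fun y => and_congr_right fun _ => ?_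
  have : ((unif hπ : Kˣ) : K) • y = π • y := algebraMap_smul K π y
  rw [this]

theorem units_smul_mono (α : Kˣ) {L M : Submodule O (Fin 3 → K)} (h : L ≤ M) :
    α • L ≤ α • M := by
  rw [Units.smul_def, Units.smul_def]
  exact smul_mono_right (α : K) h

variable (K)

/-- The one-skeleton of the building: distinct vertices `[L]` and `[M]` are joined by an edge
if `L ⊇ α M ⊇ π L` for some nonzero `α` in `K`. -/
def graph [FaithfulSMul O K] {π : O} (hπ : Irreducible π) : SimpleGraph (Vertex O K) where
  Adj u v := u ≠ v ∧ ∃ L M : Lattice O K, Vertex.mk L = u ∧ Vertex.mk M = v ∧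
    ∃ α : Kˣ, α • M.1 ≤ L.1 ∧ π • L.1 ≤ α • M.1
  symm := ⟨by
    rintro u v ⟨hne, L, M, hL, hM, α, h1, h2⟩
    refine ⟨hne.symm, M, L, hM, hL, α⁻¹ * unif hπ, ?_, ?_⟩
    · have h := units_smul_mono α⁻¹ h2
      rwa [inv_smul_smul, ← unif_smul hπ, smul_smul] at h
    · have h := units_smul_mono (α⁻¹ * unif hπ) h1
      rwa [smul_smul, mul_right_comm, inv_mul_cancel, one_mul, unif_smul] at h⟩
  loopless := ⟨fun _ h => h.1 rfl⟩

variable {K}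

/-- The lattice spanned by `a₀ e₀, a₁ e₁, a₂ e₂`, where `e₀, e₁, e₂` is the standard basis
of `K³`. -/
def diagonal (a : Fin 3 → Kˣ) : Lattice O K :=
  ⟨Submodule.span O (Set.range fun j => Pi.single j (a j : K)),
    { fg := Submodule.fg_span (Set.finite_range _)
      span_eq_top := by
        rw [Submodule.span_span_of_tower, eq_top_iff]
        rintro x -
        rw [pi_eq_sum_univ' x]
        refine Submodule.sum_mem _ fun j _ => ?_
        have h : Pi.single j (a j : K) ∈
            Submodule.span K (Set.range fun j : Fin 3 => Pi.single (M := fun _ => K) j (a j : K)) :=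
          Submodule.subset_span ⟨j, rfl⟩
        have h2 := Submodule.smul_mem _ (x j * (a j : K)⁻¹) h
        convert h2 using 1
        ext i
        by_cases hij : i = j
        · subst hij; simp
        · simp [hij] }⟩

theorem mem_diagonal (a : Fin 3 → Kˣ) (x : Fin 3 → K) :
    x ∈ (diagonal (O := O) a).1 ↔ ∀ j, ∃ c : O, x j = algebraMap O K c * a j := by
  unfold diagonal
  rw [Submodule.mem_span_range_iff_exists_fun]
  constructor
  · rintro ⟨c, rfl⟩ j
    refine ⟨c j, ?_⟩
    simp [Finset.sum_apply, Pi.single_apply, Algebra.smul_def]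
  · intro h
    choose c hc using h
    refine ⟨c, ?_⟩
    ext j
    simp [Finset.sum_apply, Pi.single_apply, Algebra.smul_def, hc j]

variable (K) [FaithfulSMul O K] {π : O} (hπ : Irreducible π)

theorem graph_adj_diagonal (a b : Fin 3 → Kˣ) (ha : a 0 = 1) (hb : b 0 = 1) (j : Fin 3)
    (haj : a j = 1) (hbj : b j = unif hπ) (h : ∀ i, b i = a i ∨ b i = unif hπ * a i) :
    (graph K hπ).Adj (Vertex.mk (diagonal a)) (Vertex.mk (diagonal b)) := by
  have hinj := FaithfulSMul.algebraMap_injective O K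
  have hsingle : ∀ (c : Fin 3 → Kˣ) (i : Fin 3), c i = 1 →
      (Pi.single i (1 : K) : Fin 3 → K) ∈ (diagonal (O := O) c).1 := by
    intro c i hc
    refine Submodule.subset_span ⟨i, ?_⟩
    simp [hc]
  refine ⟨fun hab => ?_, diagonal a, diagonal b, rfl, rfl, 1, ?_, ?_⟩
  · obtain ⟨α, hα⟩ := Vertex.mk_eq_mk.1 hab
    rw [Units.smul_def] at hα
    have h1 := hsingle b 0 hb
    rw [← hα, Submodule.mem_smul_pointwise_iff_exists] at h1
    obtain ⟨x, hx, hx'⟩ := h1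
    obtain ⟨c, hc⟩ := (mem_diagonal a x).1 hx 0
    have h2 := Submodule.smul_mem_pointwise_smul _ (α : K) _ (hsingle a j haj)
    rw [hα, mem_diagonal] at h2
    obtain ⟨d, hd⟩ := h2 j
    have hx0 := congrFun hx' 0
    simp only [Pi.smul_apply, smul_eq_mul, Pi.single_eq_same, mul_one, ha, hbj, hc, unif,
      Units.val_one, Units.val_mk0] at hx0 hd
    refine hπ.not_isUnit (IsUnit.of_mul_eq_one (d * c) (hinj ?_))
    rw [map_mul, map_mul, map_one, ← hx0, hd]
    ring
  · rw [one_smul]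
    intro x hx
    rw [mem_diagonal] at hx ⊢
    intro i
    obtain ⟨c, hc⟩ := hx i
    rcases h i with hi | hi
    · exact ⟨c, by rw [hc, hi]⟩
    · exact ⟨c * π, by rw [hc, hi, unif]; simp [mul_assoc]⟩
  · rw [one_smul]
    intro x hx
    rw [Submodule.mem_smul_pointwise_iff_exists] at hx
    obtain ⟨y, hy, rfl⟩ := hx
    rw [mem_diagonal] at hy ⊢
    intro i
    obtain ⟨c, hc⟩ := hy i
    rcases h i with hi | hi
    · exact ⟨π * c, by rw [Pi.smul_apply, hc, hi, Algebra.smul_def, map_mul, mul_assoc]⟩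
    · exact ⟨c, by rw [Pi.smul_apply, hc, hi, Algebra.smul_def, unif]; simp; ring⟩

open Classical in
/-- The hyperspecial chamber, with vertices `[⟨e₀, e₁, e₂⟩]`, `[⟨e₀, e₁, π e₂⟩]` and
`[⟨e₀, π e₁, π e₂⟩]`. -/
noncomputable def hyperspecialChamber : Building.Chamber (graph K hπ) :=
  ⟨{Vertex.mk (diagonal ![1, 1, 1]), Vertex.mk (diagonal ![1, 1, unif hπ]),
    Vertex.mk (diagonal ![1, unif hπ, unif hπ])}, by
      rw [SimpleGraph.is3Clique_triple_iff]
      refine ⟨graph_adj_diagonal K hπ _ _ rfl rfl 2 rfl rfl ?_,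
        graph_adj_diagonal K hπ _ _ rfl rfl 1 rfl rfl ?_,
        graph_adj_diagonal K hπ _ _ rfl rfl 1 rfl rfl ?_⟩
      all_goals
        intro i
        fin_cases i <;> simp⟩

end A2Building

/-! Filter `K³` by the periodic lattice chain `fil j` whose classes are the vertices of `C`; its
successive quotients are lines over the residue field. The jumps of a lattice `L` along this chain
form a set stable under adding 3, so they are recorded by three integers `pos L r`, the least jump
in each class modulo 3. This is the retraction onto the standard apartment centred at `C`. A chamber
at `[L]` is a flag `L ⊃ M ⊃ N ⊃ πL`, which removes these three jumps in some order.

The `depth` of `[L]` adds up the differences of the positions, divided by 3 and rounded down. The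
length of a chamber at `[L]` is this depth plus the number of inversions in the order of removal.
Length is gallery distance (`dist_hyperspecialChamber`): an adjacency changes it by at most one, and
a chamber of nonzero length has a shorter neighbour. Hence `Δ_n` consists of the vertices of depth
at most `n`.

For (1), a lattice between `πL` and `L` that keeps only an upper part of the jumps of `L` must be
`πL + L ∩ fil c` (`eq_of_coord_eq_iff`). So the ascending flag is unique, and its chamber is the
summit. A neighbour of `[L]` removes a proper nonempty set of the three jumps; at positive depth,
the depth drops only for {lowest} and {lowest, middle}, which are the two base vertices.

For (2), the depth is kept only for {middle} and {lowest, top}, and the second case is the first one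
for the pair `M`, `πL`. If `M` removes the middle jump, removing the lowest one next gives a lattice
`X` of smaller depth, hence a vertex of both bases; the flag `L ⊃ M ⊃ X` has one inversion, so
length `n + 1`. The only other order beginning with the middle jump has two inversions. -/

/-! ### The valuation ring of a finite extension of `ℚ_p`. -/

theorem integralClosure_valuationRing (p : ℕ) [Fact p.Prime] (K : Type*) [Field K]
    [Algebra ℚ_[p] K] [FiniteDimensional ℚ_[p] K]
    [Algebra ℤ_[p] K] [IsScalarTower ℤ_[p] ℚ_[p] K] :
    ValuationRing (integralClosure ℤ_[p] K) := by
  have : IsFractionRing (integralClosure ℤ_[p] K) K :=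
    integralClosure.isFractionRing_of_finite_extension ℚ_[p] K
  -- Spectral norm at most 1 bounds the coefficients of the minimal polynomial, which therefore
  -- lifts to a monic polynomial over `ℤ_p`. Multiplicativity of the norm then puts `x` or `x⁻¹` in
  -- the ring.
  have key : ∀ x : K, spectralNorm ℚ_[p] K x ≤ 1 → x ∈ integralClosure ℤ_[p] K := by
    intro x hx
    have hint : IsIntegral ℚ_[p] x := Algebra.IsIntegral.isIntegral x
    rw [spectralNorm, spectralValue_le_one_iff (minpoly.monic hint)] at hx
    have hl : minpoly ℚ_[p] x ∈ Polynomial.lifts (algebraMap ℤ_[p] ℚ_[p]) := by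
      rw [Polynomial.lifts_iff_coeff_lifts]
      exact fun k => ⟨⟨_, hx k⟩, rfl⟩
    obtain ⟨q, hq, -, hqm⟩ := Polynomial.lifts_and_natDegree_eq_and_monic hl (minpoly.monic hint)
    refine ⟨q, hqm, ?_⟩
    have := minpoly.aeval ℚ_[p] x
    rw [← hq, Polynomial.aeval_map_algebraMap] at this
    exact this
  rw [ValuationRing.iff_isInteger_or_isInteger _ K]
  intro x
  by_cases hx : spectralNorm ℚ_[p] K x ≤ 1
  · exact Or.inl ⟨⟨x, key x hx⟩, rfl⟩
  · refine Or.inr ⟨⟨x⁻¹, key _ ?_⟩, rfl⟩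
    have h1 : spectralNorm ℚ_[p] K (x * x⁻¹) = spectralNorm ℚ_[p] K x * spectralNorm ℚ_[p] K x⁻¹ :=
      spectralAlgNorm_mul x x⁻¹
    have hx0 : x ≠ 0 := by
      rintro rfl
      exact hx (by rw [spectralNorm_zero]; exact zero_le_one)
    rw [mul_inv_cancel₀ hx0, spectralNorm_one] at h1
    have := spectralNorm_nonneg (K := ℚ_[p]) (L := K) x⁻¹
    by_contra! h
    push Not at hx
    nlinarith

theorem integralClosure_isDiscreteValuationRing (p : ℕ) [Fact p.Prime] (K : Type*) [Field K]
    [Algebra ℚ_[p] K] [FiniteDimensional ℚ_[p] K]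
    [Algebra ℤ_[p] K] [IsScalarTower ℤ_[p] ℚ_[p] K]
    {π : integralClosure ℤ_[p] K} (hπ : Irreducible π) :
    IsDiscreteValuationRing (integralClosure ℤ_[p] K) := by
  have := integralClosure_valuationRing p K
  have : CharZero ℚ_[p] := inferInstance
  have : IsDedekindDomain (integralClosure ℤ_[p] K) := integralClosure.isDedekindDomain ℤ_[p] ℚ_[p] K
  have hf : ¬ IsField (integralClosure ℤ_[p] K) := fun h => by
    obtain ⟨y, hy⟩ := h.mul_inv_cancel hπ.ne_zero
    exact hπ.not_isUnit (IsUnit.of_mul_eq_one _ hy)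
  exact ((IsDiscreteValuationRing.TFAE _ hf).out 0 2).2 this

/-! ### The standard periodic lattice chain. -/

namespace A2Building

section Filtration

variable {O K : Type*} [CommRing O] [Field K] [Algebra O K] [FaithfulSMul O K] {π : O} (hπ : Irreducible π)


theorem mem_unif_zpow_smul {n : ℤ} {L : Submodule O (Fin 3 → K)} {x : Fin 3 → K} :
    x ∈ (unif hπ ^ n : Kˣ) • L ↔ (unif hπ ^ (-n) : Kˣ) • x ∈ L := by
  rw [zpow_neg]
  exact Submodule.mem_smul_pointwise_iff_exists _ _ _ |>.trans
    ⟨by rintro ⟨y, hy, rfl⟩; exact (inv_smul_smul (unif hπ ^ n : Kˣ) y).symm ▸ hy,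
      fun h => ⟨_, h, smul_inv_smul (unif hπ ^ n : Kˣ) x⟩⟩

/-- The complete periodic chain of lattices whose homothety classes form the hyperspecial
chamber. -/
def stdLattice (j : ℤ) : Lattice O K := diagonal fun i => unif hπ ^ ((j + (i : ℕ)) / 3)

/-- The underlying submodules of the standard lattice chain. -/
abbrev fil (j : ℤ) : Submodule O (Fin 3 → K) := (stdLattice hπ j).1

theorem mem_fil {j : ℤ} {x : Fin 3 → K} :
    x ∈ fil hπ j ↔ ∀ i : Fin 3, ∃ c : O,
      x i = algebraMap O K c * ((unif hπ ^ ((j + (i : ℕ)) / 3) : Kˣ) : K) :=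
  mem_diagonal _ _

theorem exists_mul_unif_zpow_of_le {a b : ℤ} (h : a ≤ b) (c : O) :
    ∃ d : O, algebraMap O K c * ((unif hπ ^ b : Kˣ) : K) =
      algebraMap O K d * ((unif hπ ^ a : Kˣ) : K) := by
  obtain ⟨n, rfl⟩ := Int.le.dest h
  refine ⟨c * π ^ n, ?_⟩
  rw [add_comm, zpow_add, Units.val_mul, zpow_natCast, Units.val_pow_eq_pow_val, map_mul, map_pow,
    mul_assoc]
  rfl

theorem fil_antitone : Antitone (fil (K := K) hπ) := by
  intro a b h x hx
  rw [mem_fil] at hx ⊢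
  intro i
  obtain ⟨c, hc⟩ := hx i
  obtain ⟨d, hd⟩ := exists_mul_unif_zpow_of_le (K := K) hπ
    (show (a + (i : ℕ)) / 3 ≤ (b + (i : ℕ)) / 3 by omega) c
  exact ⟨d, hc.trans hd⟩

theorem unif_zpow_smul_mem_fil {n j : ℤ} {x : Fin 3 → K} :
    (unif hπ ^ n : Kˣ) • x ∈ fil hπ j ↔ x ∈ fil hπ (j - 3 * n) := by
  rw [mem_fil, mem_fil]
  refine forall_congr' fun i => exists_congr fun c => ?_
  rw [show (j - 3 * n + (i : ℕ)) / 3 = -n + (j + (i : ℕ)) / 3 by omega, zpow_add, zpow_neg,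
    Units.val_mul, Units.smul_def, Pi.smul_apply, smul_eq_mul, mul_left_comm,
    Units.eq_inv_mul_iff_mul_eq]

theorem exists_mem_fil_notMem (j : ℤ) : ∃ x : Fin 3 → K, x ∈ fil hπ j ∧ x ∉ fil hπ (j + 1) := by
  -- The one coordinate whose exponent rises between levels `j` and `j + 1`.
  obtain ⟨i, hi⟩ : ∃ i : Fin 3, (j + (i : ℕ) + 1) % 3 = 0 :=
    ⟨⟨((-j - 1) % 3).toNat, by omega⟩, by simp only; omega⟩
  refine ⟨Pi.single i ((unif hπ ^ ((j + (i : ℕ)) / 3) : Kˣ) : K), ?_, fun h => ?_⟩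
  · exact Submodule.subset_span ⟨i, rfl⟩
  · obtain ⟨c, hc⟩ := (mem_fil hπ).1 h i
    rw [show (j + 1 + (i : ℕ)) / 3 = 1 + (j + (i : ℕ)) / 3 by omega, Pi.single_eq_same, zpow_add,
      Units.val_mul, zpow_one, ← mul_assoc, eq_comm] at hc
    replace hc := (mul_eq_right₀ (Units.ne_zero _)).1 hc
    refine hπ.not_isUnit (IsUnit.of_mul_eq_one_right c
      (FaithfulSMul.algebraMap_injective O K ?_))
    rw [map_mul, map_one, ← hc]
    rfl

variable [IsDomain O] [IsDiscreteValuationRing O]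

/-- Successive quotients of the standard chain are one-dimensional. -/
theorem exists_sub_smul_mem_fil {j : ℤ} {x y : Fin 3 → K} (hx : x ∈ fil hπ j)
    (hy : y ∈ fil hπ j) (hy' : y ∉ fil hπ (j + 1)) : ∃ a : O, x - a • y ∈ fil hπ (j + 1) := by
  rw [mem_fil] at hx hy
  choose c hc using hx
  choose d hd using hy
  obtain ⟨i, hi⟩ : ∃ i : Fin 3, (j + (i : ℕ) + 1) % 3 = 0 :=
    ⟨⟨((-j - 1) % 3).toNat, by omega⟩, by simp only; omega⟩
  have hother : ∀ i' : Fin 3, i' ≠ i → (j + 1 + (i' : ℕ)) / 3 = (j + (i' : ℕ)) / 3 := by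
    intro i' h
    have := Fin.val_ne_of_ne h
    omega
  have hsame : (j + 1 + (i : ℕ)) / 3 = (j + (i : ℕ)) / 3 + 1 := by omega
  -- If `d i` were divisible by `π`, then `y` would already lie one level deeper.
  have hu : IsUnit (d i) := by
    by_contra hnu
    have : d i ∈ IsLocalRing.maximalIdeal O := hnu
    rw [hπ.maximalIdeal_eq, Ideal.mem_span_singleton] at this
    obtain ⟨e, he⟩ := this
    refine hy' ((mem_fil hπ).2 fun i' => ?_)
    by_cases h : i' = i
    · subst h
      refine ⟨e, ?_⟩
      rw [hd, he, hsame, zpow_add_one, Units.val_mul, map_mul]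
      simp only [unif, Units.val_mk0]
      ring
    · exact ⟨d i', by rw [hd, hother i' h]⟩
  obtain ⟨u, hu⟩ := hu
  refine ⟨c i * (u⁻¹ : Oˣ), (mem_fil hπ).2 fun i' => ?_⟩
  by_cases h : i' = i
  · subst h
    refine ⟨0, ?_⟩
    have : algebraMap O K ((u⁻¹ : Oˣ) : O) * algebraMap O K (d i') = 1 := by
      rw [← map_mul, ← hu]
      simp
    rw [Pi.sub_apply, Pi.smul_apply, hc, hd, Algebra.smul_def, map_mul, map_zero]
    linear_combination (-(algebraMap O K (c i') * ((unif hπ ^ ((j + (i' : ℕ)) / 3) : Kˣ) : K))) *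
      this
  · refine ⟨c i' - c i * (u⁻¹ : Oˣ) * d i', ?_⟩
    rw [Pi.sub_apply, Pi.smul_apply, hc, hd, Algebra.smul_def, hother i' h]
    simp only [map_sub, map_mul]
    ring

variable [IsFractionRing O K]

/-- Every nonzero scalar is a unit of `O` times a power of the uniformiser. -/
theorem exists_eq_unit_mul_unif_zpow (α : Kˣ) :
    ∃ (u : Oˣ) (n : ℤ), (α : K) = algebraMap O K u * ((unif hπ ^ n : Kˣ) : K) := by
  obtain ⟨x, y, hy, hxy⟩ := IsFractionRing.div_surjective (A := O) (α : K)
  have hy0 : y ≠ 0 := nonZeroDivisors.ne_zero hy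
  have hx0 : x ≠ 0 := by
    rintro rfl
    exact α.ne_zero (by rw [← hxy]; simp)
  obtain ⟨m, u, rfl⟩ := IsDiscreteValuationRing.eq_unit_mul_pow_irreducible hx0 hπ
  obtain ⟨n, v, rfl⟩ := IsDiscreteValuationRing.eq_unit_mul_pow_irreducible hy0 hπ
  refine ⟨u * v⁻¹, (m : ℤ) - n, ?_⟩
  have hv : algebraMap O K v ≠ 0 := by
    rw [map_ne_zero_iff _ (FaithfulSMul.algebraMap_injective O K)]
    exact v.ne_zero
  have hp : algebraMap O K π ≠ 0 := (unif (K := K) hπ).ne_zero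
  have huv : algebraMap O K ((v⁻¹ : Oˣ) : O) = (algebraMap O K v)⁻¹ := by
    refine eq_inv_of_mul_eq_one_left ?_
    rw [← map_mul]
    simp
  rw [← hxy, Units.val_mul, map_mul _ (u : O) ((v⁻¹ : Oˣ) : O), huv, Units.val_zpow_eq_zpow_val, unif, Units.val_mk0,
    zpow_sub₀ hp]
  simp only [map_mul, map_pow, zpow_natCast]
  field_simp

/-- Scaling a submodule by a scalar only depends on the valuation of the scalar. -/
theorem exists_unif_zpow_smul_eq (α : Kˣ) :
    ∃ n : ℤ, ∀ L : Submodule O (Fin 3 → K), α • L = (unif hπ ^ n : Kˣ) • L := by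
  obtain ⟨u, n, h⟩ := exists_eq_unit_mul_unif_zpow (K := K) hπ α
  refine ⟨n, fun L => le_antisymm ?_ ?_⟩
  · intro x hx
    rw [Units.smul_def, Submodule.mem_smul_pointwise_iff_exists] at hx ⊢
    obtain ⟨y, hy, rfl⟩ := hx
    refine ⟨(u : O) • y, L.smul_mem _ hy, ?_⟩
    rw [h, ← algebraMap_smul K (u : O) y, smul_smul, mul_comm]
  · intro x hx
    rw [Units.smul_def, Submodule.mem_smul_pointwise_iff_exists] at hx ⊢
    obtain ⟨y, hy, rfl⟩ := hx
    refine ⟨((u⁻¹ : Oˣ) : O) • y, L.smul_mem _ hy, ?_⟩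
    rw [h, ← algebraMap_smul K ((u⁻¹ : Oˣ) : O) y, smul_smul, mul_right_comm, ← map_mul]
    simp

theorem exists_mem_fil (x : Fin 3 → K) : ∃ N : ℤ, x ∈ fil hπ N := by
  have : ∀ i : Fin 3, ∃ n : ℤ, ∃ c : O, x i = algebraMap O K c * ((unif hπ ^ n : Kˣ) : K) := by
    intro i
    by_cases h : x i = 0
    · exact ⟨0, 0, by simp [h]⟩
    · obtain ⟨u, n, hn⟩ := exists_eq_unit_mul_unif_zpow (K := K) hπ (Units.mk0 _ h)
      exact ⟨n, u, hn⟩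
  choose n c hc using this
  -- Level `3m` of the chain is `π ^ m O³`.
  refine ⟨3 * min (n 0) (min (n 1) (n 2)), (mem_fil hπ).2 fun i => ?_⟩
  obtain ⟨d, hd⟩ := exists_mul_unif_zpow_of_le (K := K) hπ
    (show (3 * min (n 0) (min (n 1) (n 2)) + (i : ℕ)) / 3 ≤ n i by
      fin_cases i <;> simp <;> omega) (c i)
  exact ⟨d, (hc i).trans hd⟩

theorem exists_le_fil (L : Lattice O K) : ∃ N : ℤ, L.1 ≤ fil hπ N := by
  obtain ⟨S, hS⟩ := L.2.fg
  choose N hN using exists_mem_fil (K := K) hπ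
  rw [← hS]
  rcases S.eq_empty_or_nonempty with rfl | hne
  · exact ⟨0, by simp⟩
  · refine ⟨S.inf' hne N, Submodule.span_le.2 fun x hx => ?_⟩
    exact fil_antitone hπ (Finset.inf'_le N hx) (hN x)

theorem exists_fil_le (L : Lattice O K) : ∃ N : ℤ, fil hπ N ≤ L.1 := by
  have key : ∀ x : Fin 3 → K, ∃ n : ℕ, π ^ n • x ∈ L.1 := by
    intro x
    have hx : x ∈ Submodule.span K (L.1 : Set (Fin 3 → K)) := by
      rw [L.2.span_eq_top]; trivial
    induction hx using Submodule.span_induction with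
    | mem x h => exact ⟨0, by simpa using h⟩
    | zero => exact ⟨0, by simp⟩
    | add x y _ _ hx hy =>
      obtain ⟨m, hm⟩ := hx
      obtain ⟨n, hn⟩ := hy
      refine ⟨m + n, ?_⟩
      rw [smul_add]
      refine L.1.add_mem ?_ ?_
      · rw [add_comm, pow_add, mul_smul]
        exact L.1.smul_mem _ hm
      · rw [pow_add, mul_smul]
        exact L.1.smul_mem _ hn
    | smul a x _ hx =>
      obtain ⟨m, hm⟩ := hx
      by_cases ha : a = 0
      · exact ⟨0, by simp [ha]⟩
      obtain ⟨u, n, hn⟩ := exists_eq_unit_mul_unif_zpow (K := K) hπ (Units.mk0 _ ha)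
      rw [Units.val_mk0] at hn
      obtain ⟨c, hc⟩ := exists_mul_unif_zpow_of_le (K := K) hπ
        (show (0 : ℤ) ≤ n + (-n).toNat by omega) (u : O)
      rw [zpow_add, zpow_zero, Units.val_one, mul_one, Units.val_mul, zpow_natCast,
        Units.val_pow_eq_pow_val, ← mul_assoc, ← hn] at hc
      refine ⟨m + (-n).toNat, ?_⟩
      have : π ^ (m + (-n).toNat) • a • x = c • π ^ m • x := by
        rw [← algebraMap_smul K c, ← hc, ← algebraMap_smul K (π ^ m),
          ← algebraMap_smul K (π ^ (m + _)), smul_smul, smul_smul, unif, Units.val_mk0, map_pow,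
          map_pow]
        congr 1
        ring
      rw [this]
      exact L.1.smul_mem _ hm
  choose n hn using key
  let e : Fin 3 → Fin 3 → K := fun i => Pi.single i 1
  refine ⟨3 * (n (e 0) + n (e 1) + n (e 2) : ℕ), Submodule.span_le.2 ?_⟩
  rintro _ ⟨i, rfl⟩
  have hi : n (e i) ≤ n (e 0) + n (e 1) + n (e 2) := by fin_cases i <;> simp <;> omega
  obtain ⟨k, hk⟩ := Nat.le.dest hi
  have : (Pi.single i ((unif hπ ^ ((3 * (n (e 0) + n (e 1) + n (e 2) : ℕ) + (i : ℕ) : ℤ) / 3) : Kˣ)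
      : K) : Fin 3 → K) = π ^ k • π ^ n (e i) • e i := by
    rw [show (3 * (n (e 0) + n (e 1) + n (e 2) : ℕ) + (i : ℕ) : ℤ) / 3 =
      ((n (e 0) + n (e 1) + n (e 2) : ℕ) : ℤ) by omega, zpow_natCast, smul_smul, ← pow_add,
      add_comm k, hk]
    ext i'
    by_cases h : i' = i
    · subst h
      simp [e, Algebra.smul_def, unif]
    · simp [e, h]
  rw [SetLike.mem_coe]
  simp only
  rw [this]
  exact L.1.smul_mem _ (hn _)

end Filtration

end A2Building

/-! ### Jumps and coordinates of a lattice. -/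

namespace A2Building

section Jumps

variable {O K : Type*} [CommRing O] [Field K] [Algebra O K] [FaithfulSMul O K] {π : O}
  (hπ : Irreducible π)

/-- The integer `j` is a jump of `L` if some vector of `L` lies in the `j`-th but not in the
`(j + 1)`-st lattice of the standard chain. -/
def IsJump (L : Submodule O (Fin 3 → K)) (j : ℤ) : Prop :=
  ∃ x ∈ L, x ∈ fil hπ j ∧ x ∉ fil hπ (j + 1)

variable {hπ}

theorem IsJump.mono {L M : Submodule O (Fin 3 → K)} (h : L ≤ M) {j : ℤ} :
    IsJump hπ L j → IsJump hπ M j :=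
  fun ⟨x, hx, hj⟩ => ⟨x, h hx, hj⟩

theorem isJump_unif_zpow_smul {L : Submodule O (Fin 3 → K)} {n j : ℤ} :
    IsJump hπ ((unif hπ ^ n : Kˣ) • L) j ↔ IsJump hπ L (j - 3 * n) := by
  constructor
  · rintro ⟨x, hx, h1, h2⟩
    refine ⟨_, (mem_unif_zpow_smul hπ).1 hx, ?_, ?_⟩
    · rw [unif_zpow_smul_mem_fil]
      convert h1 using 2
      omega
    · rw [unif_zpow_smul_mem_fil]
      convert h2 using 3
      omega
  · rintro ⟨x, hx, h1, h2⟩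
    refine ⟨(unif hπ ^ n : Kˣ) • x, (mem_unif_zpow_smul hπ).2 ?_, ?_, ?_⟩
    · rw [zpow_neg, inv_smul_smul]
      exact hx
    · rwa [unif_zpow_smul_mem_fil]
    · rw [unif_zpow_smul_mem_fil]
      convert h2 using 3
      omega

theorem unif_zpow_smul_le {n : ℤ} (hn : 0 ≤ n) (L : Submodule O (Fin 3 → K)) :
    (unif hπ ^ n : Kˣ) • L ≤ L := by
  lift n to ℕ using hn
  intro x hx
  rw [zpow_natCast, Units.smul_def, Submodule.mem_smul_pointwise_iff_exists] at hx
  obtain ⟨y, hy, rfl⟩ := hx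
  have : ((unif hπ ^ n : Kˣ) : K) • y = π ^ n • y := by
    rw [← algebraMap_smul K (π ^ n) y, map_pow]
    rfl
  rw [this]
  exact L.smul_mem _ hy

theorem isJump_of_fil_le {L : Submodule O (Fin 3 → K)} {N j : ℤ} (h : fil hπ N ≤ L) (hj : N ≤ j) :
    IsJump hπ L j := by
  obtain ⟨x, h1, h2⟩ := exists_mem_fil_notMem (K := K) hπ j
  exact ⟨x, h (fil_antitone hπ hj h1), h1, h2⟩

theorem IsJump.le_of_le_fil {L : Submodule O (Fin 3 → K)} {N j : ℤ} (h : L ≤ fil hπ N)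
    (hj : IsJump hπ L j) : N ≤ j := by
  obtain ⟨x, hx, -, h2⟩ := hj
  by_contra! hlt
  exact h2 (fil_antitone hπ (by omega) (h hx))

theorem IsJump.add_three {L : Submodule O (Fin 3 → K)} {j : ℤ} (h : IsJump hπ L j) :
    IsJump hπ L (j + 3) := by
  refine IsJump.mono (unif_zpow_smul_le (hπ := hπ) zero_le_one L) ?_
  rw [isJump_unif_zpow_smul]
  convert h using 1
  omega

variable [IsDomain O] [IsDiscreteValuationRing O]

/-- A vector outside `M` can be changed by an element of `M` so that its level is not a jump
of `M`. -/
theorem exists_sub_notMem_isJump {M : Submodule O (Fin 3 → K)} {N : ℤ} (hN : fil hπ N ≤ M)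
    {z : Fin 3 → K} (hz : z ∉ M) {j : ℤ} (hj : z ∈ fil hπ j) :
    ∃ m ∈ M, ∃ i, j ≤ i ∧ z - m ∈ fil hπ i ∧ z - m ∉ fil hπ (i + 1) ∧ ¬ IsJump hπ M i := by
  -- The level of `z` is raised step by step by subtracting elements of `M`. This must stop before
  -- level `N`, from which on everything lies in `M`.
  induction hd : (N - j).toNat generalizing z j with
  | zero => exact absurd (hN (fil_antitone hπ (by omega) hj)) hz
  | succ d ih =>
    by_cases hz1 : z ∈ fil hπ (j + 1)
    · obtain ⟨m, hm, i, hi, h⟩ := ih hz hz1 (by omega)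
      exact ⟨m, hm, i, by omega, h⟩
    by_cases hJ : IsJump hπ M j
    · obtain ⟨y, hy, hy1, hy2⟩ := hJ
      obtain ⟨a, ha⟩ := exists_sub_smul_mem_fil hπ hj hy1 hy2
      have hay := M.smul_mem a hy
      obtain ⟨m, hm, i, hi, h⟩ := ih (fun h => hz (by simpa using M.add_mem h hay)) ha (by omega)
      refine ⟨a • y + m, M.add_mem hay hm, i, by omega, ?_⟩
      rwa [← sub_sub]
    · exact ⟨0, M.zero_mem, j, le_rfl, by simpa using hj, by simpa using hz1, hJ⟩

/-- Adjoining to `M` a vector of `L` adds exactly one jump. -/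
theorem exists_isJump_iff_or_eq {L M : Lattice O K} (hML : M.1 ≤ L.1) (hLM : π • L.1 ≤ M.1)
    {j : ℤ} (hL : IsJump hπ L.1 j) (hM : ¬ IsJump hπ M.1 j) :
    ∃ X : Lattice O K, M.1 ≤ X.1 ∧ X.1 ≤ L.1 ∧
      ∀ i, IsJump hπ X.1 i ↔ IsJump hπ M.1 i ∨ i = j := by
  obtain ⟨x, hx, hx1, hx2⟩ := hL
  have := M.2
  refine ⟨⟨M.1 ⊔ Submodule.span O {x}, Submodule.IsLattice.of_le_of_isLattice_of_fg K le_sup_left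
    (M.2.fg.sup (Submodule.fg_span_singleton x))⟩, le_sup_left,
    sup_le hML ((Submodule.span_singleton_le_iff_mem _ _).2 hx), fun i => ⟨?_, ?_⟩⟩
  · rintro ⟨y, hy, hy1, hy2⟩
    obtain ⟨m, hm, z, hz, rfl⟩ := Submodule.mem_sup.1 hy
    obtain ⟨a, rfl⟩ := Submodule.mem_span_singleton.1 hz
    -- For a unit `a`, no cancellation with `m` occurs at level `j`, since `j` is not a jump of `M`.
    -- For a nonunit, `a • x` lies in `πL ≤ M` and contributes nothing new.
    by_cases ha : IsUnit a
    · obtain ⟨u, rfl⟩ := ha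
      rw [or_iff_not_imp_right]
      intro hij
      rcases lt_or_gt_of_ne hij with hlt | hgt
      · have hux : (u : O) • x ∈ fil hπ (i + 1) :=
          Submodule.smul_mem _ _ (fil_antitone hπ (by omega) hx1)
        exact ⟨m, hm, (Submodule.add_mem_iff_left _ (fil_antitone hπ (by omega) hux)).1 hy1,
          fun h => hy2 (Submodule.add_mem _ h hux)⟩
      · refine absurd ⟨m, hm, ?_, fun h => hx2 ?_⟩ hM
        · exact (Submodule.add_mem_iff_left _ (Submodule.smul_mem _ _ hx1)).1
            (fil_antitone hπ hgt.le hy1)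
        · have := (Submodule.add_mem_iff_right _ h).1 (fil_antitone hπ (by omega) hy1)
          simpa [smul_smul] using Submodule.smul_mem _ ((u⁻¹ : Oˣ) : O) this
    · have : a ∈ IsLocalRing.maximalIdeal O := ha
      rw [hπ.maximalIdeal_eq, Ideal.mem_span_singleton] at this
      obtain ⟨e, rfl⟩ := this
      refine Or.inl ⟨_, M.1.add_mem hm (hLM ?_), hy1, hy2⟩
      rw [mul_smul]
      exact Submodule.smul_mem_pointwise_smul _ _ _ (L.1.smul_mem _ hx)
  · rintro (h | rfl)
    · exact h.mono le_sup_left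
    · exact ⟨x, le_sup_right (a := M.1) (Submodule.mem_span_singleton_self x), hx1, hx2⟩

variable [IsFractionRing O K]

/-- A vector of `L` outside `M` could be moved by `M` to a level that is not a jump of `M`; it stays
in `L`, so that level is a jump of `L`. Nested lattices are thus told apart by their jumps. -/
theorem le_of_isJump_imp {L M : Submodule O (Fin 3 → K)} {N : ℤ} (hN : fil hπ N ≤ M)
    (hML : M ≤ L) (h : ∀ j, IsJump hπ L j → IsJump hπ M j) : L ≤ M := by
  intro z hz
  by_contra hzM
  obtain ⟨j, hj⟩ := exists_mem_fil hπ z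
  obtain ⟨m, hm, i, -, h1, h2, h3⟩ := exists_sub_notMem_isJump hN hzM hj
  exact h3 (h i ⟨_, L.sub_mem hz (hML hm), h1, h2⟩)

/-- If the jumps of `X` are those of `M` and those of `L` from `c` on, then `X` is determined by
`L`, `M` and `c`. -/
theorem eq_sup_inf_fil {L M X : Submodule O (Fin 3 → K)} {N c : ℤ} (hN : fil hπ N ≤ M)
    (hMX : M ≤ X) (hXL : X ≤ L)
    (h : ∀ j, IsJump hπ X j ↔ IsJump hπ M j ∨ IsJump hπ L j ∧ c ≤ j) :
    X = M ⊔ L ⊓ fil hπ c := by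
  have h1 : L ⊓ fil hπ c ≤ X := by
    rintro z ⟨hzL, hzc⟩
    by_contra hzX
    obtain ⟨m, hm, i, hi, h1, h2, h3⟩ := exists_sub_notMem_isJump (hN.trans hMX) hzX hzc
    exact h3 ((h i).2 (Or.inr ⟨⟨_, L.sub_mem hzL (hXL hm), h1, h2⟩, hi⟩))
  refine le_antisymm (le_of_isJump_imp (hN.trans le_sup_left) (sup_le hMX h1) fun j hj => ?_)
    (sup_le hMX h1)
  rcases (h j).1 hj with hj | ⟨⟨x, hx, hx1, hx2⟩, hcj⟩
  · exact hj.mono le_sup_left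
  · exact ⟨x, Submodule.mem_sup_right ⟨hx, fil_antitone hπ hcj hx1⟩, hx1, hx2⟩

variable (hπ) in
/-- The coordinates of a lattice: `3 * coord L r + r` is its smallest jump congruent to `r`
modulo three. -/
noncomputable def coord (L : Lattice O K) (r : Fin 3) : ℤ :=
  sInf {k | IsJump hπ L.1 (3 * k + (r : ℕ))}

/-- `L` lies between two members of the chain, so the jumps in a residue class are nonempty and
bounded below, and the infimum is attained; stability under adding 3 makes them a half-line. -/
theorem isJump_iff_coord_le {L : Lattice O K} {r : Fin 3} {k : ℤ} :
    IsJump hπ L.1 (3 * k + (r : ℕ)) ↔ coord hπ L r ≤ k := by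
  obtain ⟨N, hN⟩ := exists_le_fil hπ L
  obtain ⟨N', hN'⟩ := exists_fil_le hπ L
  have hne : {k | IsJump hπ L.1 (3 * k + (r : ℕ))}.Nonempty :=
    ⟨max N' 0, isJump_of_fil_le hN' (by omega)⟩
  have hbdd : BddBelow {k | IsJump hπ L.1 (3 * k + (r : ℕ))} := by
    refine ⟨min 0 N - 2, fun k hk => ?_⟩
    have := IsJump.le_of_le_fil hN hk
    omega
  refine ⟨fun h => csInf_le hbdd h, fun h => ?_⟩
  obtain ⟨n, rfl⟩ := Int.le.dest h
  induction n with
  | zero =>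
    rw [Nat.cast_zero, add_zero]
    exact Int.csInf_mem hne hbdd
  | succ n ih =>
    convert (ih (by omega)).add_three using 1
    push_cast
    ring

theorem coord_eq_of_forall {L : Lattice O K} {r : Fin 3} {c : ℤ}
    (h : ∀ k, IsJump hπ L.1 (3 * k + (r : ℕ)) ↔ c ≤ k) : coord hπ L r = c :=
  le_antisymm (isJump_iff_coord_le.1 ((h c).2 le_rfl)) ((h _).1 (isJump_iff_coord_le.2 le_rfl))

theorem coord_anti {L M : Lattice O K} (h : L.1 ≤ M.1) (r : Fin 3) :
    coord hπ M r ≤ coord hπ L r :=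
  isJump_iff_coord_le.1 ((isJump_iff_coord_le.2 le_rfl).mono h)

theorem coord_of_eq_smul {L M : Lattice O K} {n : ℤ} (h : M.1 = (unif hπ ^ n : Kˣ) • L.1)
    (r : Fin 3) : coord hπ M r = coord hπ L r + n := by
  refine coord_eq_of_forall fun k => ?_
  rw [h, isJump_unif_zpow_smul, show 3 * k + (r : ℕ) - 3 * n = 3 * (k - n) + (r : ℕ) by ring,
    isJump_iff_coord_le]
  omega

theorem exists_eq_three_mul_add (j : ℤ) : ∃ (k : ℤ) (r : Fin 3), j = 3 * k + (r : ℕ) :=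
  ⟨j / 3, ⟨(j % 3).toNat, by omega⟩, by simp only; omega⟩

theorem eq_of_le_of_coord_eq {L M : Lattice O K} (hML : M.1 ≤ L.1)
    (h : ∀ r, coord hπ M r = coord hπ L r) : M = L := by
  obtain ⟨N, hN⟩ := exists_fil_le hπ M
  refine Subtype.ext (le_antisymm hML (le_of_isJump_imp hN hML fun j hj => ?_))
  obtain ⟨k, r, rfl⟩ := exists_eq_three_mul_add j
  rw [isJump_iff_coord_le] at hj ⊢
  rwa [h]

/-- Between `π L` and `L`, a lattice whose jumps are an upper part of those of `L` is determined
by its jumps. -/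
theorem eq_of_coord_eq_iff {L X Y : Lattice O K} (hX : X.1 ≤ L.1) (hX' : π • L.1 ≤ X.1)
    (hY : Y.1 ≤ L.1) (hY' : π • L.1 ≤ Y.1) (c : ℤ)
    (hcX : ∀ r : Fin 3, coord hπ X r = if c ≤ 3 * coord hπ L r + (r : ℕ) then coord hπ L r
      else coord hπ L r + 1)
    (hcY : ∀ r : Fin 3, coord hπ Y r = coord hπ X r) : X = Y := by
  have key : ∀ Z : Lattice O K, Z.1 ≤ L.1 → π • L.1 ≤ Z.1 →
      (∀ r, coord hπ Z r = coord hπ X r) → Z.1 = π • L.1 ⊔ L.1 ⊓ fil hπ c := by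
    intro Z hZ hZ' hcZ
    have := L.2
    let P : Lattice O K := ⟨(unif hπ ^ (1 : ℤ) : Kˣ) • L.1, inferInstance⟩
    have hP : P.1 = π • L.1 := by rw [← unif_smul hπ]; simp [P]
    obtain ⟨N, hN⟩ := exists_fil_le hπ P
    rw [← hP] at hZ' ⊢
    refine eq_sup_inf_fil hN hZ' hZ fun j => ?_
    obtain ⟨k, r, rfl⟩ := exists_eq_three_mul_add j
    rw [isJump_iff_coord_le, isJump_iff_coord_le, isJump_iff_coord_le,
      coord_of_eq_smul (show P.1 = _ from rfl), hcZ, hcX]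
    split_ifs <;> omega
  exact Subtype.ext ((key X hX hX' fun _ => rfl).trans (key Y hY hY' hcY).symm)

theorem exists_coord_eq {L M : Lattice O K} (hML : M.1 ≤ L.1) (hLM : π • L.1 ≤ M.1) {r : Fin 3}
    (hr : coord hπ M r = coord hπ L r + 1) :
    ∃ X : Lattice O K, M.1 ≤ X.1 ∧ X.1 ≤ L.1 ∧
      ∀ s, coord hπ X s = if s = r then coord hπ L r else coord hπ M s := by
  obtain ⟨X, h1, h2, h3⟩ := exists_isJump_iff_or_eq hML hLM
    (j := 3 * coord hπ L r + (r : ℕ)) (isJump_iff_coord_le.2 le_rfl)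
    (by rw [isJump_iff_coord_le]; omega)
  refine ⟨X, h1, h2, fun s => coord_eq_of_forall fun k => ?_⟩
  rw [h3, isJump_iff_coord_le]
  split_ifs with hs
  · subst hs
    omega
  · have : (s : ℕ) ≠ r := Fin.val_ne_of_ne hs
    omega

theorem coord_stdLattice (j : ℤ) (r : Fin 3) :
    coord hπ (stdLattice (O := O) (K := K) hπ j) r = (j + 2 - (r : ℕ)) / 3 := by
  refine coord_eq_of_forall fun k => ⟨fun h => ?_, fun h => ?_⟩
  · have := h.le_of_le_fil le_rfl
    omega
  · exact isJump_of_fil_le le_rfl (by omega)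

end Jumps

end A2Building

/-! ### Vertices, flags and the length of a chamber. -/

namespace A2Building

theorem exists_mk_eq {O K : Type*} [CommRing O] [Field K] [Algebra O K] (v : Vertex O K) :
    ∃ L : Lattice O K, Vertex.mk L = v :=
  Quotient.exists_rep v

section Vertices

variable {O K : Type*} [CommRing O] [Field K] [Algebra O K] [FaithfulSMul O K] {π : O}
  (hπ : Irreducible π)

/-- The multiple of a lattice by a power of the uniformiser. -/
def shift (n : ℤ) (L : Lattice O K) : Lattice O K :=
  ⟨(unif hπ ^ n : Kˣ) • L.1, have := L.2; inferInstance⟩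

variable {hπ}

theorem shift_one (L : Lattice O K) : (shift hπ 1 L).1 = π • L.1 := by
  rw [← unif_smul hπ]
  simp [shift]

theorem shift_zero (L : Lattice O K) : shift hπ 0 L = L :=
  Subtype.ext (by simp [shift])

theorem shift_shift (m n : ℤ) (L : Lattice O K) : shift hπ m (shift hπ n L) = shift hπ (m + n) L :=
  Subtype.ext (by simp [shift, zpow_add, smul_smul])

theorem shift_le (L : Lattice O K) {n : ℤ} (hn : 0 ≤ n) : (shift hπ n L).1 ≤ L.1 :=
  unif_zpow_smul_le hn L.1

theorem shift_mono {L M : Lattice O K} (h : L.1 ≤ M.1) (n : ℤ) :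
    (shift hπ n L).1 ≤ (shift hπ n M).1 :=
  units_smul_mono _ h

theorem mk_shift (n : ℤ) (L : Lattice O K) : Vertex.mk (shift hπ n L) = Vertex.mk L :=
  (Vertex.mk_eq_mk.2 ⟨_, rfl⟩ : Vertex.mk L = _).symm

variable [IsDomain O] [IsDiscreteValuationRing O] [IsFractionRing O K]

variable (hπ) in
theorem exists_eq_shift {L M : Lattice O K} (h : Vertex.mk L = Vertex.mk M) :
    ∃ n : ℤ, M = shift hπ n L := by
  obtain ⟨α, hα⟩ := Vertex.mk_eq_mk.1 h
  obtain ⟨n, hn⟩ := exists_unif_zpow_smul_eq (K := K) hπ α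
  exact ⟨n, Subtype.ext (by rw [← hα, hn]; rfl)⟩

theorem coord_shift (n : ℤ) (L : Lattice O K) (r : Fin 3) :
    coord hπ (shift hπ n L) r = coord hπ L r + n :=
  coord_of_eq_smul rfl r

variable (hπ) in
/-- The neighbours of the vertex of `L` are the vertices of the lattices strictly between `L`
and `π L`. -/
theorem adj_mk_iff {L : Lattice O K} {v : Vertex O K} :
    (graph K hπ).Adj (Vertex.mk L) v ↔ ∃ M : Lattice O K, Vertex.mk M = v ∧ M.1 ≤ L.1 ∧
      (shift hπ 1 L).1 ≤ M.1 ∧ M ≠ L ∧ M ≠ shift hπ 1 L := by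
  constructor
  · rintro ⟨hne, L', M', hL', hM', α, h1, h2⟩
    obtain ⟨m, rfl⟩ := exists_eq_shift hπ hL'
    obtain ⟨n, hn⟩ := exists_unif_zpow_smul_eq (K := K) hπ α
    have h3 : α • M'.1 = (shift hπ n M').1 := hn _
    rw [h3] at h1 h2
    rw [← shift_one (hπ := hπ)] at h2
    have hv : Vertex.mk (shift hπ (m + n) M') = v := by rw [mk_shift, hM']
    refine ⟨shift hπ (m + n) M', hv, ?_, ?_, ?_, ?_⟩
    · have := shift_mono (hπ := hπ) h1 m
      rwa [shift_shift] at this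
    · have := shift_mono (hπ := hπ) h2 m
      rwa [shift_shift, shift_shift, add_comm m 1, ← shift_shift 1] at this
    · intro h
      exact hne (by rw [← hv, h])
    · intro h
      exact hne (by rw [← hv, h, mk_shift 1])
  · rintro ⟨M, rfl, h1, h2, h3, h4⟩
    refine ⟨fun h => ?_, L, M, rfl, rfl, 1, by rwa [one_smul], by rwa [one_smul, ← shift_one]⟩
    obtain ⟨n, rfl⟩ := exists_eq_shift hπ h
    have ha := coord_anti (hπ := hπ) h1 0
    have hb := coord_anti (hπ := hπ) h2 0
    rw [coord_shift] at ha hb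
    rw [coord_shift] at hb
    obtain rfl | rfl : n = 0 ∨ n = 1 := by omega
    · exact h3 (shift_zero L)
    · exact h4 rfl

/-- Lattices that represent adjacent vertices are comparable. -/
theorem le_or_le_of_adj {M N : Lattice O K}
    (h : (graph K hπ).Adj (Vertex.mk M) (Vertex.mk N)) : M.1 ≤ N.1 ∨ N.1 ≤ M.1 := by
  obtain ⟨P, hP, h1, h2, -⟩ := (adj_mk_iff hπ).1 h
  obtain ⟨n, rfl⟩ := exists_eq_shift hπ hP
  have hs : ∀ a b : ℤ, a ≤ b → (shift hπ b P).1 ≤ (shift hπ a P).1 := by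
    intro a b hab
    have := shift_le (hπ := hπ) (shift hπ a P) (n := b - a) (by omega)
    rwa [shift_shift, sub_add_cancel] at this
  rcases le_or_gt 0 n with hn | hn
  · refine Or.inr ((hs 0 n hn).trans ?_)
    rwa [shift_zero]
  · refine Or.inl (le_trans ?_ (hs n (-1) (by omega)))
    have := shift_mono (hπ := hπ) h2 (-1)
    rwa [shift_shift, neg_add_cancel, shift_zero] at this

variable (hπ) in
/-- The smallest jump of `L` congruent to `r` modulo three. -/
noncomputable def pos (L : Lattice O K) (r : Fin 3) : ℤ := 3 * coord hπ L r + (r : ℕ)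

variable (hπ) in
/-- The number of walls of the standard apartment with direction given by `r` and `s` that
separate the retraction of a vertex from the hyperspecial chamber. -/
noncomputable def gap (r s : Fin 3) (v : Vertex O K) : ℕ :=
  Quotient.lift (fun L : Lattice O K => (pos hπ L s - pos hπ L r).natAbs / 3) (fun L M h => by
      obtain ⟨n, rfl⟩ := exists_eq_shift hπ (Quotient.sound h : Vertex.mk L = Vertex.mk M)
      simp only [pos, coord_shift]
      congr 2
      ring) v

theorem gap_mk (r s : Fin 3) (L : Lattice O K) :
    gap hπ r s (Vertex.mk L) = (pos hπ L s - pos hπ L r).natAbs / 3 :=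
  rfl

theorem gap_comm (r s : Fin 3) (v : Vertex O K) : gap hπ r s v = gap hπ s r v := by
  induction v using Quotient.inductionOn with
  | _ L =>
    change (pos hπ L s - pos hπ L r).natAbs / 3 = (pos hπ L r - pos hπ L s).natAbs / 3
    omega

theorem sum_pairs_eq {f : Fin 3 → Fin 3 → ℕ} (hf : ∀ i j, f i j = f j i) {r s t : Fin 3}
    (hrs : r ≠ s) (hrt : t ≠ r) (hst : t ≠ s) :
    f 0 1 + f 0 2 + f 1 2 = f r s + f r t + f s t := by
  have := hf 0 1
  have := hf 0 2
  have := hf 1 2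
  obtain rfl | rfl | rfl : r = 0 ∨ r = 1 ∨ r = 2 := by omega
  all_goals
    obtain rfl | rfl | rfl : s = 0 ∨ s = 1 ∨ s = 2 := by omega
    all_goals
      obtain rfl | rfl | rfl : t = 0 ∨ t = 1 ∨ t = 2 := by omega
      all_goals omega

variable (hπ) in
/-- The least distance from the hyperspecial chamber of a chamber containing a vertex. -/
noncomputable def depth (v : Vertex O K) : ℕ := gap hπ 0 1 v + gap hπ 0 2 v + gap hπ 1 2 v

/-- The distance from the hyperspecial chamber to a chamber. -/
noncomputable def length (D : Building.Chamber (graph K hπ)) : ℕ :=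
  D.1.sup (gap hπ 0 1) + D.1.sup (gap hπ 0 2) + D.1.sup (gap hπ 1 2)

theorem depth_le_length {D : Building.Chamber (graph K hπ)} {v : Vertex O K} (hv : v ∈ D.1) :
    depth hπ v ≤ length D :=
  add_le_add (add_le_add (Finset.le_sup hv) (Finset.le_sup hv)) (Finset.le_sup hv)

variable (hπ) in
/-- A lattice flag `L ⊃ M ⊃ N ⊃ π L` in which `M` and `N` are obtained from the lattice before
them by removing a jump congruent to `r` and to `s`. -/
structure IsFlag (L M N : Lattice O K) (r s : Fin 3) : Prop where
  ne : r ≠ s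
  le₁ : M.1 ≤ L.1
  le₂ : N.1 ≤ M.1
  le₃ : (shift hπ 1 L).1 ≤ N.1
  coord₁ : ∀ i, coord hπ M i = if i = r then coord hπ L i + 1 else coord hπ L i
  coord₂ : ∀ i, coord hπ N i = if i = r ∨ i = s then coord hπ L i + 1 else coord hπ L i

theorem exists_ne_and_ne (r s : Fin 3) : ∃ t : Fin 3, t ≠ r ∧ t ≠ s := by
  revert r s
  decide

theorem IsFlag.adj {L M N : Lattice O K} {r s : Fin 3} (h : IsFlag hπ L M N r s) :
    (graph K hπ).Adj (Vertex.mk L) (Vertex.mk M) ∧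
      (graph K hπ).Adj (Vertex.mk L) (Vertex.mk N) ∧
      (graph K hπ).Adj (Vertex.mk M) (Vertex.mk N) := by
  have hr1 := h.coord₁ r
  have hs1 := h.coord₁ s
  have hr2 := h.coord₂ r
  have hs2 := h.coord₂ s
  obtain ⟨t, htr, hts⟩ := exists_ne_and_ne r s
  have ht2 := h.coord₂ t
  simp only [h.ne, h.ne.symm, htr, hts, if_true, if_false, or_true, or_false]
    at hr1 hs1 hr2 hs2 ht2
  refine ⟨(adj_mk_iff hπ).2 ⟨M, rfl, h.le₁, h.le₃.trans h.le₂, ?_, ?_⟩,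
    (adj_mk_iff hπ).2 ⟨N, rfl, h.le₂.trans h.le₁, h.le₃, ?_, ?_⟩,
    (adj_mk_iff hπ).2 ⟨N, rfl, h.le₂, (shift_mono h.le₁ 1).trans h.le₃, ?_, ?_⟩⟩
  all_goals
    intro heq
    have er := congrArg (fun X => coord hπ X r) heq
    have es := congrArg (fun X => coord hπ X s) heq
    have et := congrArg (fun X => coord hπ X t) heq
    try simp only [coord_shift] at er es et
    omega

open Classical in
/-- The chamber of a lattice flag. -/
noncomputable def IsFlag.chamber {L M N : Lattice O K} {r s : Fin 3} (h : IsFlag hπ L M N r s) :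
    Building.Chamber (graph K hπ) :=
  ⟨{Vertex.mk L, Vertex.mk M, Vertex.mk N}, SimpleGraph.is3Clique_triple_iff.2 h.adj⟩

theorem IsFlag.mem_chamber {L M N : Lattice O K} {r s : Fin 3} (h : IsFlag hπ L M N r s)
    {v : Vertex O K} :
    v ∈ h.chamber.1 ↔ v = Vertex.mk L ∨ v = Vertex.mk M ∨ v = Vertex.mk N := by
  simp [IsFlag.chamber]

/-- Every chamber containing the vertex of `L` comes from a lattice flag starting at `L`. -/
theorem exists_isFlag {D : Building.Chamber (graph K hπ)} {L : Lattice O K}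
    (hL : Vertex.mk L ∈ D.1) :
    ∃ (M N : Lattice O K) (r s : Fin 3) (h : IsFlag hπ L M N r s), D = h.chamber := by
  classical
  obtain ⟨u, v, hLu, hLv, huv, hD⟩ : ∃ u v, (graph K hπ).Adj (Vertex.mk L) u ∧
      (graph K hπ).Adj (Vertex.mk L) v ∧ (graph K hπ).Adj u v ∧ D.1 = {Vertex.mk L, u, v} := by
    obtain ⟨a, b, c, hab, hac, hbc, hD⟩ := SimpleGraph.is3Clique_iff.1 D.2
    rw [hD] at hL ⊢
    simp only [Finset.mem_insert, Finset.mem_singleton] at hL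
    rcases hL with h | h | h
    · exact ⟨b, c, h ▸ hab, h ▸ hac, hbc, by rw [h]⟩
    · exact ⟨a, c, h ▸ hab.symm, h ▸ hbc, hac, by rw [h, Finset.insert_comm]⟩
    · refine ⟨a, b, h ▸ hac.symm, h ▸ hbc.symm, hab, ?_⟩
      rw [h]
      ext
      simp only [Finset.mem_insert, Finset.mem_singleton]
      tauto
  obtain ⟨M, rfl, hM1, hM2, hM3, hM4⟩ := (adj_mk_iff hπ).1 hLu
  obtain ⟨N, rfl, hN1, hN2, hN3, hN4⟩ := (adj_mk_iff hπ).1 hLv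
  wlog hle : N.1 ≤ M.1 generalizing M N
  · refine this N hLv hN1 hN2 hN3 hN4 M hLu huv.symm ?_ hM1 hM2 hM3 hM4
      ((le_or_le_of_adj huv).resolve_right hle)
    rw [hD, Finset.pair_comm]
  have hNM : N ≠ M := fun h => huv.ne (by rw [h])
  -- Each of the three strict inclusions raises some coordinate, while from `L` to `πL` every
  -- coordinate rises by exactly 1. So each inclusion raises just one, and the three residues
  -- differ.
  have e1 : ∃ r, coord hπ M r ≠ coord hπ L r := by
    by_contra! h; exact hM3 (eq_of_le_of_coord_eq hM1 h)
  have e2 : ∃ s, coord hπ N s ≠ coord hπ M s := by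
    by_contra! h; exact hNM (eq_of_le_of_coord_eq hle h)
  have e3 : ∃ t, coord hπ (shift hπ 1 L) t ≠ coord hπ N t := by
    by_contra! h; exact hN4 (eq_of_le_of_coord_eq hN2 h).symm
  obtain ⟨r, hr⟩ := e1
  obtain ⟨s, hs⟩ := e2
  obtain ⟨t, ht⟩ := e3
  have b1 := fun i => coord_anti (hπ := hπ) hM1 i
  have b2 := fun i => coord_anti (hπ := hπ) hle i
  have b3 := fun i => coord_anti (hπ := hπ) hN2 i
  simp only [coord_shift] at b3 ht
  have hrs : r ≠ s := by
    rintro rfl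
    have := b1 r; have := b2 r; have := b3 r
    omega
  have hrt : r ≠ t := by
    rintro rfl
    have := b1 r; have := b2 r; have := b3 r
    omega
  have hst : s ≠ t := by
    rintro rfl
    have := b1 s; have := b2 s; have := b3 s
    omega
  have hall : ∀ i, i = r ∨ i = s ∨ i = t := by
    intro i
    omega
  have hflag : IsFlag hπ L M N r s := by
    refine ⟨hrs, hM1, hle, hN2, fun i => ?_, fun i => ?_⟩ <;>
    · have := b1 i; have := b2 i; have := b3 i
      rcases hall i with rfl | rfl | rfl
      all_goals
        simp only [hrs, hrs.symm, hrt.symm, hst.symm, if_true, if_false, true_or, or_true, or_self]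
        omega
  refine ⟨M, N, r, s, hflag, Subtype.ext ?_⟩
  ext x
  rw [hD, hflag.mem_chamber]
  simp

/-- A flag may be rotated without changing its chamber. -/
theorem IsFlag.rotate {L M N : Lattice O K} {r s t : Fin 3} (h : IsFlag hπ L M N r s)
    (hr : t ≠ r) (hs : t ≠ s) : IsFlag hπ M N (shift hπ 1 L) s t where
  ne := hs.symm
  le₁ := h.le₂
  le₂ := h.le₃
  le₃ := shift_mono h.le₁ 1
  coord₁ i := by
    have := h.ne
    rw [h.coord₁, h.coord₂]
    split_ifs <;> simp_all
  coord₂ i := by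
    have := h.ne
    rw [h.coord₁, coord_shift]
    obtain rfl | rfl | rfl : i = r ∨ i = s ∨ i = t := by omega
    all_goals simp [hs.symm, hr, h.ne, h.ne.symm, hr.symm]

theorem IsFlag.rotate_chamber {L M N : Lattice O K} {r s t : Fin 3} (h : IsFlag hπ L M N r s)
    (hr : t ≠ r) (hs : t ≠ s) : (h.rotate hr hs).chamber = h.chamber := by
  refine Subtype.ext (Finset.ext fun v => ?_)
  rw [IsFlag.mem_chamber, IsFlag.mem_chamber, mk_shift]
  tauto

theorem depth_mk {L : Lattice O K} {r s t : Fin 3} (hrs : r ≠ s) (hr : t ≠ r) (hs : t ≠ s) :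
    depth hπ (Vertex.mk L) = (pos hπ L s - pos hπ L r).natAbs / 3 +
      (pos hπ L t - pos hπ L r).natAbs / 3 + (pos hπ L t - pos hπ L s).natAbs / 3 :=
  sum_pairs_eq (f := fun i j => gap hπ i j (Vertex.mk L)) (fun i j => gap_comm i j _) hrs hr hs

/-- The length of the chamber of a flag, in terms of the order in which jumps are removed. -/
theorem IsFlag.length_chamber {L M N : Lattice O K} {r s t : Fin 3} (h : IsFlag hπ L M N r s)
    (hr : t ≠ r) (hs : t ≠ s) :
    length h.chamber = ((pos hπ L s - pos hπ L r) / 3).natAbs +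
      ((pos hπ L t - pos hπ L r) / 3).natAbs + ((pos hπ L t - pos hπ L s) / 3).natAbs := by
  have hsum := sum_pairs_eq (f := fun i j => h.chamber.1.sup (gap hπ i j))
    (fun i j => by simp only [funext (gap_comm (hπ := hπ) i j)]) h.ne hr hs
  have hsup : ∀ i j, h.chamber.1.sup (gap hπ i j) = max (gap hπ i j (Vertex.mk L))
      (max (gap hπ i j (Vertex.mk M)) (gap hπ i j (Vertex.mk N))) := fun i j => by
    simp [IsFlag.chamber]
  have hne := h.ne
  have h1 := h.coord₁ r
  have h2 := h.coord₁ s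
  have h3 := h.coord₁ t
  have h4 := h.coord₂ r
  have h5 := h.coord₂ s
  have h6 := h.coord₂ t
  simp only [hne, hne.symm, hr, hs, if_true, if_false, or_true, or_false] at h1 h2 h3 h4 h5 h6
  refine hsum.trans (congrArg₂ _ (congrArg₂ _ ?_ ?_) ?_)
  all_goals
    simp only [hsup, gap_mk, pos, h1, h2, h3, h4, h5, h6]
    omega

end Vertices

end A2Building

/-! ### Gallery distance from the hyperspecial chamber. -/

namespace A2Building

section Distance

variable {O K : Type*} [CommRing O] [Field K] [Algebra O K] [FaithfulSMul O K] {π : O}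
  {hπ : Irreducible π}

theorem IsFlag.coord_third {L M N : Lattice O K} {r s t : Fin 3} (h : IsFlag hπ L M N r s)
    (hr : t ≠ r) (hs : t ≠ s) : coord hπ M t = coord hπ L t ∧ coord hπ N t = coord hπ L t :=
  ⟨by rw [h.coord₁, if_neg hr], by rw [h.coord₂, if_neg (by tauto)]⟩

theorem adj_of_mem_edge {D E : Building.Chamber (graph K hπ)} {u v : Vertex O K} (huv : u ≠ v)
    (hne : D ≠ E) (hu : u ∈ D.1) (hv : v ∈ D.1) (hu' : u ∈ E.1) (hv' : v ∈ E.1) :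
    (Building.Chamber.graph (graph K hπ)).Adj D E := by
  classical
  refine ⟨hne, {u, v}, Finset.card_pair huv, ?_, ?_⟩
  all_goals
    intro w hw
    simp only [Finset.mem_insert, Finset.mem_singleton] at hw
    rcases hw with rfl | rfl <;> assumption

theorem mk_stdLattice_mem (j : ℤ) :
    Vertex.mk (stdLattice hπ j) ∈ (hyperspecialChamber K hπ).1 := by
  classical
  have hshift : ∀ e q : ℤ, stdLattice (O := O) (K := K) hπ (e + 3 * q) =
      shift hπ q (stdLattice hπ e) := by
    intro e q
    refine Subtype.ext (Submodule.ext fun x => ?_)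
    change _ ↔ x ∈ (unif hπ ^ q : Kˣ) • fil hπ e
    rw [mem_unif_zpow_smul, unif_zpow_smul_mem_fil]
    congr! 2
    ring
  rw [show j = j % 3 + 3 * (j / 3) by omega, hshift, mk_shift]
  obtain h | h | h : j % 3 = 0 ∨ j % 3 = 1 ∨ j % 3 = 2 := by omega
  all_goals
    rw [h, stdLattice, hyperspecialChamber]
    simp only [Finset.mem_insert, Finset.mem_singleton]
  · refine Or.inl (congrArg _ (congrArg _ (funext fun i => ?_)))
    fin_cases i <;> simp
  · refine Or.inr (Or.inl (congrArg _ (congrArg _ (funext fun i => ?_))))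
    fin_cases i <;> simp
  · refine Or.inr (Or.inr (congrArg _ (congrArg _ (funext fun i => ?_))))
    fin_cases i <;> simp

theorem exists_stdLattice_of_mem {v : Vertex O K} (hv : v ∈ (hyperspecialChamber K hπ).1) :
    ∃ j : ℤ, v = Vertex.mk (stdLattice hπ j) := by
  classical
  simp only [hyperspecialChamber, Finset.mem_insert, Finset.mem_singleton] at hv
  rcases hv with rfl | rfl | rfl
  · refine ⟨0, congrArg _ (congrArg _ (funext fun i => ?_))⟩
    fin_cases i <;> simp
  · refine ⟨1, congrArg _ (congrArg _ (funext fun i => ?_))⟩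
    fin_cases i <;> simp
  · refine ⟨2, congrArg _ (congrArg _ (funext fun i => ?_))⟩
    fin_cases i <;> simp

variable [IsDomain O] [IsDiscreteValuationRing O] [IsFractionRing O K]

theorem IsFlag.ne_shift₁ {L M N : Lattice O K} {r s : Fin 3} (h : IsFlag hπ L M N r s) :
    M ≠ shift hπ 1 L := by
  obtain ⟨t, hr, hs⟩ := exists_ne_and_ne r s
  rintro rfl
  have := (h.coord_third hr hs).1
  rw [coord_shift] at this
  omega

theorem IsFlag.ne_shift₂ {L M N : Lattice O K} {r s : Fin 3} (h : IsFlag hπ L M N r s) :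
    N ≠ shift hπ 1 L := by
  obtain ⟨t, hr, hs⟩ := exists_ne_and_ne r s
  rintro rfl
  have := (h.coord_third hr hs).2
  rw [coord_shift] at this
  omega

/-- A vertex is represented by at most one lattice strictly between `π L` and `L`. -/
theorem eq_of_mk_eq {L X Y : Lattice O K} (hX : X.1 ≤ L.1) (hX' : (shift hπ 1 L).1 ≤ X.1)
    (hXL : X ≠ shift hπ 1 L) (hY : Y.1 ≤ L.1) (hY' : (shift hπ 1 L).1 ≤ Y.1)
    (hYL : Y ≠ shift hπ 1 L) (h : Vertex.mk X = Vertex.mk Y) : X = Y := by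
  obtain ⟨n, rfl⟩ := exists_eq_shift hπ h
  have key : ∀ (Z : Lattice O K) (m : ℤ), 1 ≤ m → Z.1 ≤ L.1 →
      (shift hπ 1 L).1 ≤ (shift hπ m Z).1 → shift hπ m Z = shift hπ 1 L := by
    intro Z m hm hZ h
    refine Subtype.ext (le_antisymm ?_ h)
    have := shift_mono (hπ := hπ) ((shift_le (hπ := hπ) Z (n := m - 1) (by omega)).trans hZ) 1
    rwa [shift_shift, add_sub_cancel] at this
  rcases lt_trichotomy n 0 with hn | rfl | hn
  · refine absurd ?_ hXL
    have := key (shift hπ n X) (-n) (by omega) hY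
    rw [shift_shift, neg_add_cancel, shift_zero] at this
    exact this hX'
  · exact (shift_zero X).symm
  · exact absurd (key X n hn hX hY') hYL

/-- There is a flag starting at `L` for every order of removing jumps. -/
theorem exists_isFlag_of_ne (L : Lattice O K) {r s : Fin 3} (hrs : r ≠ s) :
    ∃ M N : Lattice O K, IsFlag hπ L M N r s := by
  obtain ⟨t, hr, hs⟩ := exists_ne_and_ne r s
  have hle := shift_le (hπ := hπ) L zero_le_one
  -- The flag is built upwards from `πL`, restoring the jump at `t` and then the one at `s`.
  obtain ⟨N, hN1, hN2, hN⟩ := exists_coord_eq (r := t) hle (shift_one (hπ := hπ) L).ge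
    (coord_shift 1 L t)
  have hNs : coord hπ N s = coord hπ L s + 1 := by
    rw [hN, if_neg hs.symm, coord_shift]
  obtain ⟨M, hM1, hM2, hM⟩ := exists_coord_eq (r := s) hN2 ((shift_one (hπ := hπ) L).ge.trans hN1)
    hNs
  refine ⟨M, N, hrs, hM2, hM1, hN1, fun i => ?_, fun i => ?_⟩
  all_goals
    obtain rfl | rfl | rfl : i = r ∨ i = s ∨ i = t := by omega
    all_goals simp [hM, hN, coord_shift, hrs, hrs.symm, hr, hs, hr.symm, hs.symm]

/-- The middle lattice of a flag can be changed so as to remove the two jumps in the other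
order. -/
theorem IsFlag.exists_swap {L M N : Lattice O K} {r s : Fin 3} (h : IsFlag hπ L M N r s) :
    ∃ M' : Lattice O K, IsFlag hπ L M' N s r := by
  have hr : coord hπ N r = coord hπ L r + 1 := by simp [h.coord₂]
  obtain ⟨M', h1, h2, h3⟩ := exists_coord_eq (h.le₂.trans h.le₁)
    ((shift_one (hπ := hπ) L).ge.trans h.le₃) hr
  refine ⟨M', h.ne.symm, h2, h1, h.le₃, fun i => ?_, fun i => ?_⟩
  · have := h.ne
    rw [h3, h.coord₂]
    split_ifs <;> simp_all
  · simp only [h.coord₂, or_comm]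

theorem ne_of_length_ne {D E : Building.Chamber (graph K hπ)} (h : length D ≠ length E) :
    D ≠ E :=
  fun hDE => h (congrArg length hDE)

theorem adj_of_isFlag {L M M' N : Lattice O K} {r s r' s' : Fin 3} (h : IsFlag hπ L M N r s)
    (h' : IsFlag hπ L M' N r' s') (hne : h.chamber ≠ h'.chamber) :
    (Building.Chamber.graph (graph K hπ)).Adj h.chamber h'.chamber :=
  adj_of_mem_edge h.adj.2.1.ne hne (h.mem_chamber.2 (Or.inl rfl))
    (h.mem_chamber.2 (Or.inr (Or.inr rfl))) (h'.mem_chamber.2 (Or.inl rfl))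
    (h'.mem_chamber.2 (Or.inr (Or.inr rfl)))

/-- Crossing one wall changes the length by at most one. -/
theorem length_le_of_adj {D E : Building.Chamber (graph K hπ)}
    (h : (Building.Chamber.graph (graph K hπ)).Adj D E) : length E ≤ length D + 1 := by
  classical
  obtain ⟨-, F, hF, hFD, hFE⟩ := h
  -- After rotation the shared edge is given by the outer lattices `L` and `N`, and only the middle
  -- lattice may vary.
  obtain ⟨L, M, N, r, s, hD, rfl, hLE, hNE⟩ : ∃ (L M N : Lattice O K) (r s : Fin 3)
      (hD : IsFlag hπ L M N r s), D = hD.chamber ∧ Vertex.mk L ∈ E.1 ∧ Vertex.mk N ∈ E.1 := by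
    obtain ⟨u, v, huv, rfl⟩ := Finset.card_eq_two.1 hF
    obtain ⟨L, rfl⟩ := exists_mk_eq u
    obtain ⟨M, N, r, s, hD, rfl⟩ := exists_isFlag (L := L) (hFD (by simp))
    obtain ⟨t, hr, hs⟩ := exists_ne_and_ne r s
    have hLE : Vertex.mk L ∈ E.1 := hFE (by simp)
    have hvE : v ∈ E.1 := hFE (by simp)
    have hvD : v ∈ hD.chamber.1 := hFD (by simp)
    rcases hD.mem_chamber.1 hvD with rfl | rfl | rfl
    · exact absurd rfl huv
    · exact ⟨_, _, _, _, _, hD.rotate hr hs, (hD.rotate_chamber hr hs).symm, hvE,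
        by rwa [mk_shift]⟩
    · exact ⟨_, _, _, _, _, hD, rfl, hLE, hvE⟩
  obtain ⟨M', N', r', s', hE, rfl⟩ := exists_isFlag hLE
  obtain ⟨t, hr, hs⟩ := exists_ne_and_ne r s
  obtain ⟨t', hr', hs'⟩ := exists_ne_and_ne r' s'
  have hN : N = N' := by
    rcases hE.mem_chamber.1 hNE with h | h | h
    · exact absurd h hD.adj.2.1.ne'
    · have := eq_of_mk_eq (hD.le₂.trans hD.le₁) hD.le₃ hD.ne_shift₂ hE.le₁ (hE.le₃.trans hE.le₂)
        hE.ne_shift₁ h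
      have h1 := hD.coord₂ r
      have h2 := hD.coord₂ s
      rw [this, hE.coord₁] at h1 h2
      have := hD.ne
      simp only [true_or, or_true, if_true] at h1 h2
      split_ifs at h1 h2 <;> omega
    · exact eq_of_mk_eq (hD.le₂.trans hD.le₁) hD.le₃ hD.ne_shift₂ (hE.le₂.trans hE.le₁) hE.le₃
        hE.ne_shift₂ h
  subst hN
  have htt : t = t' := by
    by_contra hne
    have h1 := (hD.coord_third hr hs).2
    have hne := hE.ne
    rw [hE.coord₂, if_pos (by omega)] at h1
    omega
  subst htt
  have hne := hD.ne
  have hne' := hE.ne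
  rw [hD.length_chamber hr hs, hE.length_chamber hr' hs']
  -- The lattices `L` and `N` fix the set of removed jumps. Exchanging their order affects a single
  -- summand, by at most one.
  obtain ⟨rfl, rfl⟩ | ⟨rfl, rfl⟩ : r' = r ∧ s' = s ∨ r' = s ∧ s' = r := by omega
  · omega
  · simp only [pos]
    omega

theorem le_fil_of_forall_le {L : Lattice O K} {j : ℤ} (h : ∀ r, j ≤ pos hπ L r) :
    L.1 ≤ fil hπ j := by
  intro x hx
  obtain ⟨N, hN⟩ := exists_mem_fil hπ x
  by_contra hxj
  have hstep : ∀ n : ℕ, x ∈ fil hπ (N + n) := by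
    intro n
    induction n with
    | zero => simpa using hN
    | succ n ih =>
      by_contra hn
      have hJ : IsJump hπ L.1 (N + n) := ⟨x, hx, ih, by rwa [Nat.cast_succ, ← add_assoc] at hn⟩
      obtain ⟨k, r, hk⟩ := exists_eq_three_mul_add (N + n)
      have hlt : N + n < j := by
        by_contra! hle
        exact hxj (fil_antitone hπ hle ih)
      rw [hk, isJump_iff_coord_le] at hJ
      have := h r
      rw [pos] at this
      omega
  exact hxj (fil_antitone hπ (by omega) (hstep (j - N).toNat))

/-- Depth zero puts the three positions in a window `j, j + 1, j + 2`. Then `L` lies in `fil j` and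
has the same jumps, so it equals `fil j`. -/
theorem mem_hyperspecialChamber_of_depth_eq_zero {v : Vertex O K} (h : depth hπ v = 0) :
    v ∈ (hyperspecialChamber K hπ).1 := by
  obtain ⟨L, rfl⟩ := exists_mk_eq v
  rw [depth_mk (r := 0) (s := 1) (t := 2) (by decide) (by decide) (by decide)] at h
  obtain ⟨j, hj⟩ : ∃ j : ℤ, ∀ r, j ≤ pos hπ L r ∧ pos hπ L r ≤ j + 2 := by
    refine ⟨min (pos hπ L 0) (min (pos hπ L 1) (pos hπ L 2)), fun r => ?_⟩
    obtain rfl | rfl | rfl : r = 0 ∨ r = 1 ∨ r = 2 := by omega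
    all_goals omega
  have : L = stdLattice hπ j := by
    refine eq_of_le_of_coord_eq (hπ := hπ) (le_fil_of_forall_le fun r => (hj r).1) fun r => ?_
    have := hj r
    rw [pos] at this
    rw [coord_stdLattice]
    omega
  rw [this]
  exact mk_stdLattice_mem j

theorem length_hyperspecialChamber : length (hyperspecialChamber K hπ) = 0 := by
  have : ∀ r s, (hyperspecialChamber K hπ).1.sup (gap hπ r s) = 0 := by
    intro r s
    refine Nat.le_zero.1 (Finset.sup_le fun v hv => ?_)
    obtain ⟨j, rfl⟩ := exists_stdLattice_of_mem hv
    rw [gap_mk, pos, pos, coord_stdLattice, coord_stdLattice]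
    omega
  simp [length, this]

theorem eq_hyperspecialChamber_of_length_eq_zero {D : Building.Chamber (graph K hπ)}
    (h : length D = 0) : D = hyperspecialChamber K hπ := by
  refine Subtype.ext (Finset.eq_of_subset_of_card_le (fun v hv => ?_) ?_)
  · have := depth_le_length hv
    exact mem_hyperspecialChamber_of_depth_eq_zero (by omega)
  · rw [D.2.card_eq, (hyperspecialChamber K hπ).2.card_eq]

/-- A flag whose first two jumps are removed in descending order is adjacent to a shorter
chamber. -/
theorem IsFlag.exists_adj_length_lt {L M N : Lattice O K} {r s : Fin 3}
    (h : IsFlag hπ L M N r s) (hlt : pos hπ L s < pos hπ L r) :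
    ∃ E, (Building.Chamber.graph (graph K hπ)).Adj h.chamber E ∧
      length E + 1 = length h.chamber := by
  obtain ⟨t, hr, hs⟩ := exists_ne_and_ne r s
  obtain ⟨M', h'⟩ := h.exists_swap
  have hne := h.ne
  have hlen : length h'.chamber + 1 = length h.chamber := by
    rw [h.length_chamber hr hs, h'.length_chamber hs hr]
    simp only [pos] at hlt ⊢
    omega
  exact ⟨_, adj_of_isFlag h h' (ne_of_length_ne (by omega)), hlen⟩

/-- The three rotations of a flag let each edge be crossed in turn. If none has a descent at its
first two jumps, then `pos L r ≤ pos L s ≤ pos L t ≤ pos L r + 3`, which makes the length zero. -/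
theorem exists_adj_length_lt {D : Building.Chamber (graph K hπ)} (hD : length D ≠ 0) :
    ∃ E, (Building.Chamber.graph (graph K hπ)).Adj D E ∧ length E + 1 = length D := by
  obtain ⟨v, hv⟩ : D.1.Nonempty := by
    rw [← Finset.card_pos, D.2.card_eq]
    decide
  obtain ⟨L, rfl⟩ := exists_mk_eq v
  obtain ⟨M, N, r, s, h, rfl⟩ := exists_isFlag (L := L) hv
  obtain ⟨t, hr, hs⟩ := exists_ne_and_ne r s
  by_cases h1 : pos hπ L s < pos hπ L r
  · exact h.exists_adj_length_lt h1
  have hM := h.coord_third hr hs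
  have hMs : coord hπ M s = coord hπ L s := by rw [h.coord₁, if_neg h.ne.symm]
  have hNr : coord hπ N r = coord hπ L r + 1 := by simp [h.coord₂]
  by_cases h2 : pos hπ L t < pos hπ L s
  · rw [← h.rotate_chamber hr hs]
    refine (h.rotate hr hs).exists_adj_length_lt ?_
    rw [pos, pos, hM.1, hMs]
    exact h2
  -- The flag starting at `N` removes `t` and then `r`, and the jump at `r` has by then moved up by
  -- 3.
  by_cases h3 : pos hπ L r + 3 < pos hπ L t
  · rw [← h.rotate_chamber hr hs, ← (h.rotate hr hs).rotate_chamber h.ne hr.symm]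
    refine ((h.rotate hr hs).rotate h.ne hr.symm).exists_adj_length_lt ?_
    rw [pos] at h3 ⊢
    rw [pos, hM.2, hNr]
    rw [pos] at h3
    omega
  refine absurd ?_ hD
  rw [h.length_chamber hr hs]
  have hne := h.ne
  simp only [pos] at h1 h2 h3 ⊢
  omega

/-- The gallery distance from the hyperspecial chamber is the length. -/
theorem dist_hyperspecialChamber (D : Building.Chamber (graph K hπ)) :
    (hyperspecialChamber K hπ).dist D = length D := by
  refine le_antisymm ?_ ?_
  · suffices ∀ n (D : Building.Chamber (graph K hπ)), length D = n →
        ∃ w : (Building.Chamber.graph (graph K hπ)).Walk (hyperspecialChamber K hπ) D,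
          w.length = n by
      obtain ⟨w, hw⟩ := this _ D rfl
      exact hw ▸ SimpleGraph.edist_le w
    intro n
    induction n with
    | zero =>
      intro D hD
      obtain rfl := eq_hyperspecialChamber_of_length_eq_zero hD
      exact ⟨.nil, rfl⟩
    | succ n ih =>
      intro D hD
      obtain ⟨E, hDE, hE⟩ := exists_adj_length_lt (D := D) (by omega)
      obtain ⟨w, hw⟩ := ih E (by omega)
      exact ⟨w.concat hDE.symm, by rw [SimpleGraph.Walk.length_concat, hw]⟩
  · refine le_iInf fun w => ?_
    have key : ∀ {D E : Building.Chamber (graph K hπ)}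
        (w : (Building.Chamber.graph (graph K hπ)).Walk D E), length E ≤ length D + w.length := by
      intro D E w
      induction w with
      | nil => simp
      | cons h w ih =>
        have := length_le_of_adj h
        rw [SimpleGraph.Walk.length_cons]
        omega
    have := key w
    rw [length_hyperspecialChamber, zero_add] at this
    exact_mod_cast this

/-- Every vertex lies in a chamber in whose flag the jumps are removed in ascending order. -/
theorem exists_isFlag_ascending (L : Lattice O K) :
    ∃ (M N : Lattice O K) (r s t : Fin 3), IsFlag hπ L M N r s ∧ t ≠ r ∧ t ≠ s ∧
      pos hπ L r < pos hπ L s ∧ pos hπ L s < pos hπ L t := by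
  obtain ⟨r, s, t, hrs, hr, hs, h1, h2⟩ : ∃ r s t : Fin 3, r ≠ s ∧ t ≠ r ∧ t ≠ s ∧
      pos hπ L r < pos hπ L s ∧ pos hπ L s < pos hπ L t := by
    have h01 : pos hπ L 0 ≠ pos hπ L 1 := by simp only [pos]; omega
    have h02 : pos hπ L 0 ≠ pos hπ L 2 := by simp only [pos]; omega
    have h12 : pos hπ L 1 ≠ pos hπ L 2 := by simp only [pos]; omega
    by_contra! h
    have := h 0 1 2 (by decide) (by decide) (by decide)
    have := h 0 2 1 (by decide) (by decide) (by decide)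
    have := h 1 0 2 (by decide) (by decide) (by decide)
    have := h 1 2 0 (by decide) (by decide) (by decide)
    have := h 2 0 1 (by decide) (by decide) (by decide)
    have := h 2 1 0 (by decide) (by decide) (by decide)
    omega
  obtain ⟨M, N, h⟩ := exists_isFlag_of_ne (hπ := hπ) L hrs
  exact ⟨M, N, r, s, t, h, hr, hs, h1, h2⟩

/-- Positions are distinct modulo 3, so the floor of a negative difference over 3 has absolute value
one more than the truncated quotient used in the depth. Each inversion therefore costs exactly 1. -/
theorem IsFlag.length_eq_depth_iff {L M N : Lattice O K} {r s t : Fin 3}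
    (h : IsFlag hπ L M N r s) (hr : t ≠ r) (hs : t ≠ s) :
    length h.chamber = depth hπ (Vertex.mk L) ↔
      pos hπ L r < pos hπ L s ∧ pos hπ L s < pos hπ L t := by
  have hne := h.ne
  rw [h.length_chamber hr hs, depth_mk h.ne hr hs]
  simp only [pos]
  omega

/-- The depth bounds the length of every chamber at the vertex from below, and the ascending flag
attains it. -/
theorem mem_region_iff {n : ℕ} {v : Vertex O K} :
    v ∈ Building.region (hyperspecialChamber K hπ) n ↔ depth hπ v ≤ n := by
  constructor
  · rintro ⟨D, hv, hD⟩
    rw [dist_hyperspecialChamber, Nat.cast_le] at hD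
    exact (depth_le_length hv).trans hD
  · intro h
    obtain ⟨L, rfl⟩ := exists_mk_eq v
    obtain ⟨M, N, r, s, t, hf, hr, hs, h1, h2⟩ := exists_isFlag_ascending (hπ := hπ) L
    refine ⟨hf.chamber, hf.mem_chamber.2 (Or.inl rfl), ?_⟩
    rw [dist_hyperspecialChamber, (hf.length_eq_depth_iff hr hs).2 ⟨h1, h2⟩, Nat.cast_le]
    exact h

end Distance

end A2Building

/-! ### Peaks and summits. -/

namespace A2Building

theorem eq_of_ascending {f : Fin 3 → ℤ} {r s t r' s' t' : Fin 3} (hrs : f r < f s)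
    (hst : f s < f t) (hrs' : f r' < f s') (hst' : f s' < f t') : r' = r ∧ s' = s ∧ t' = t := by
  have key : ∀ i, i = r ∨ i = s ∨ i = t := by
    have h1 : r ≠ s := fun h => hrs.ne (congrArg f h)
    have h2 : s ≠ t := fun h => hst.ne (congrArg f h)
    have h3 : r ≠ t := fun h => (hrs.trans hst).ne (congrArg f h)
    omega
  rcases key r' with h1 | h1 | h1 <;> rcases key s' with h2 | h2 | h2 <;>
    rcases key t' with h3 | h3 | h3 <;> rw [h1, h2] at hrs' <;> rw [h2, h3] at hst' <;>
    omega

section Peaks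

variable {O K : Type*} [CommRing O] [Field K] [Algebra O K] [FaithfulSMul O K] {π : O}
  {hπ : Irreducible π}

theorem IsFlag.coord₁_cases {L M N : Lattice O K} {r s : Fin 3} (h : IsFlag hπ L M N r s) :
    coord hπ M r = coord hπ L r + 1 ∧ coord hπ M s = coord hπ L s :=
  ⟨by rw [h.coord₁, if_pos rfl], by rw [h.coord₁, if_neg h.ne.symm]⟩

theorem IsFlag.coord₂_cases {L M N : Lattice O K} {r s : Fin 3} (h : IsFlag hπ L M N r s) :
    coord hπ N r = coord hπ L r + 1 ∧ coord hπ N s = coord hπ L s + 1 :=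
  ⟨by rw [h.coord₂, if_pos (Or.inl rfl)], by rw [h.coord₂, if_pos (Or.inr rfl)]⟩

variable [IsDomain O] [IsDiscreteValuationRing O] [IsFractionRing O K]

/-- In an ascending flag the second lattice is determined by its coordinates. -/
theorem IsFlag.eq_of_coord_eq₁ {L M N X : Lattice O K} {r s t : Fin 3} (h : IsFlag hπ L M N r s)
    (hr : t ≠ r) (hs : t ≠ s) (hrs : pos hπ L r < pos hπ L s) (hrt : pos hπ L r < pos hπ L t)
    (hX : X.1 ≤ L.1) (hX' : (shift hπ 1 L).1 ≤ X.1) (hc : ∀ i, coord hπ X i = coord hπ M i) :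
    X = M := by
  rw [shift_one] at hX'
  -- This cut-off discards the lowest position only.
  refine (eq_of_coord_eq_iff h.le₁ ?_ hX hX' (pos hπ L r + 1) (fun i => ?_) hc).symm
  · rw [← shift_one (hπ := hπ)]
    exact h.le₃.trans h.le₂
  · have hne := h.ne
    rw [h.coord₁]
    change _ = if _ ≤ pos hπ L i then _ else _
    obtain rfl | rfl | rfl : i = r ∨ i = s ∨ i = t := by omega
    · rw [if_pos rfl, if_neg (by omega)]
    · rw [if_neg hne.symm, if_pos (by omega)]
    · rw [if_neg hr, if_pos (by omega)]

/-- In an ascending flag the third lattice is determined by its coordinates. -/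
theorem IsFlag.eq_of_coord_eq₂ {L M N X : Lattice O K} {r s t : Fin 3} (h : IsFlag hπ L M N r s)
    (hr : t ≠ r) (hs : t ≠ s) (hrt : pos hπ L r < pos hπ L t) (hst : pos hπ L s < pos hπ L t)
    (hX : X.1 ≤ L.1) (hX' : (shift hπ 1 L).1 ≤ X.1) (hc : ∀ i, coord hπ X i = coord hπ N i) :
    X = N := by
  rw [shift_one] at hX'
  -- This cut-off keeps the highest position only.
  refine (eq_of_coord_eq_iff (h.le₂.trans h.le₁) ?_ hX hX' (pos hπ L t) (fun i => ?_) hc).symm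
  · rw [← shift_one (hπ := hπ)]
    exact h.le₃
  · have hne := h.ne
    rw [h.coord₂]
    change _ = if _ ≤ pos hπ L i then _ else _
    obtain rfl | rfl | rfl : i = r ∨ i = s ∨ i = t := by omega
    · rw [if_pos (Or.inl rfl), if_neg (by omega)]
    · rw [if_pos (Or.inr rfl), if_neg (by omega)]
    · rw [if_neg (by omega), if_pos le_rfl]

theorem IsFlag.chamber_congr {L M N M' N' : Lattice O K} {r s r' s' : Fin 3}
    (h : IsFlag hπ L M N r s) (h' : IsFlag hπ L M' N' r' s') (hM : M = M') (hN : N = N') :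
    h.chamber = h'.chamber := by
  subst hM hN
  exact Subtype.ext (Finset.ext fun v => by rw [h.mem_chamber, h'.mem_chamber])

/-- The chamber of an ascending flag at `L` is the only shortest chamber at the vertex of `L`. -/
theorem eq_chamber_of_length_eq_depth {L M N : Lattice O K} {r s t : Fin 3}
    (h : IsFlag hπ L M N r s) (hr : t ≠ r) (hs : t ≠ s) (hrs : pos hπ L r < pos hπ L s)
    (hst : pos hπ L s < pos hπ L t) {D : Building.Chamber (graph K hπ)}
    (hL : Vertex.mk L ∈ D.1) (hD : length D = depth hπ (Vertex.mk L)) : D = h.chamber := by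
  obtain ⟨M', N', r', s', h', rfl⟩ := exists_isFlag hL
  obtain ⟨t', hr', hs'⟩ := exists_ne_and_ne r' s'
  obtain ⟨h1, h2⟩ := (h'.length_eq_depth_iff hr' hs').1 hD
  obtain ⟨rfl, rfl, rfl⟩ := eq_of_ascending h1 h2 hrs hst
  refine h'.chamber_congr h
    (h.eq_of_coord_eq₁ hr hs hrs (hrs.trans hst) h'.le₁ (h'.le₃.trans h'.le₂) fun i => ?_)
    (h.eq_of_coord_eq₂ hr hs (hrs.trans hst) hst (h'.le₂.trans h'.le₁) h'.le₃ fun i => ?_)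
  · rw [h.coord₁, h'.coord₁]
  · rw [h.coord₂, h'.coord₂]

theorem exists_isSummit {n : ℕ} (hn : 0 < n) {v : Vertex O K} (hv : depth hπ v = n) :
    ∃ D, Building.IsSummit (hyperspecialChamber K hπ) n v D := by
  obtain ⟨L, rfl⟩ := exists_mk_eq v
  obtain ⟨M, N, r, s, t, h, hr, hs, hrs, hst⟩ := exists_isFlag_ascending (hπ := hπ) L
  have hne := h.ne
  have hdL := depth_mk (hπ := hπ) (L := L) h.ne hr hs
  obtain ⟨hM1, hM2⟩ := h.coord₁_cases
  obtain ⟨hN1, hN2⟩ := h.coord₂_cases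
  obtain ⟨hM3, hN3⟩ := h.coord_third hr hs
  have hdM : depth hπ (Vertex.mk M) < n := by
    rw [depth_mk h.ne hr hs]
    simp only [pos] at *
    omega
  have hdN : depth hπ (Vertex.mk N) < n := by
    rw [depth_mk h.ne hr hs]
    simp only [pos] at *
    omega
  have hlen := (h.length_eq_depth_iff hr hs).2 ⟨hrs, hst⟩
  have hbase : h.chamber.verts \ {Vertex.mk L} ⊆
      Building.region (hyperspecialChamber K hπ) (n - 1) := by
    rintro v ⟨hv, hvL⟩
    rw [mem_region_iff]
    rcases h.mem_chamber.1 hv with rfl | rfl | rfl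
    · exact absurd rfl hvL
    · omega
    · omega
  refine ⟨h.chamber, h.mem_chamber.2 (Or.inl rfl), ?_, fun D hLD hD => ?_, hbase, ?_⟩
  · rw [dist_hyperspecialChamber, hlen, hv]
  · rw [dist_hyperspecialChamber, Nat.cast_inj] at hD
    exact eq_chamber_of_length_eq_depth h hr hs hrs hst hLD (hD.trans hv.symm)
  · ext w
    constructor
    · rintro ⟨hw, hadj⟩
      rw [mem_region_iff] at hw
      obtain ⟨X, rfl, hX1, hX2, -⟩ := (adj_mk_iff hπ).1 hadj
      refine ⟨?_, hadj.ne'⟩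
      have hX1c := fun i => coord_anti (hπ := hπ) hX1 i
      have hX2c := fun i => coord_anti (hπ := hπ) hX2 i
      simp only [coord_shift] at hX2c
      -- Among the eight ways of raising coordinates by 0 or 1, only raising the lowest, or the
      -- lowest and the middle, lowers a positive depth.
      have hcases : coord hπ X r = coord hπ L r + 1 ∧ coord hπ X s = coord hπ L s ∧
            coord hπ X t = coord hπ L t ∨
          coord hπ X r = coord hπ L r + 1 ∧ coord hπ X s = coord hπ L s + 1 ∧
            coord hπ X t = coord hπ L t := by
        have a1 := hX1c r
        have a2 := hX1c s
        have a3 := hX1c t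
        have b1 := hX2c r
        have b2 := hX2c s
        have b3 := hX2c t
        rw [depth_mk h.ne hr hs] at hw
        simp only [pos] at hrs hst hw hdL
        clear hX1c hX2c hM1 hM2 hM3 hN1 hN2 hN3 hdM hdN hlen
        have hx : coord hπ X r = coord hπ L r ∨ coord hπ X r = coord hπ L r + 1 := by omega
        have hy : coord hπ X s = coord hπ L s ∨ coord hπ X s = coord hπ L s + 1 := by omega
        have hz : coord hπ X t = coord hπ L t ∨ coord hπ X t = coord hπ L t + 1 := by omega
        rcases hx with hx | hx <;> rcases hy with hy | hy <;> rcases hz with hz | hz <;>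
          rw [hx, hy, hz] at hw <;> omega
      refine h.mem_chamber.2 (Or.inr ?_)
      rcases hcases with ⟨c1, c2, c3⟩ | ⟨c1, c2, c3⟩
      · refine Or.inl (congrArg _ (h.eq_of_coord_eq₁ hr hs hrs (hrs.trans hst) hX1 hX2 fun i => ?_))
        obtain rfl | rfl | rfl : i = r ∨ i = s ∨ i = t := by omega
        all_goals omega
      · refine Or.inr (congrArg _ (h.eq_of_coord_eq₂ hr hs (hrs.trans hst) hst hX1 hX2 fun i => ?_))
        obtain rfl | rfl | rfl : i = r ∨ i = s ∨ i = t := by omega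
        all_goals omega
    · rintro ⟨hw, hwL⟩
      refine ⟨hbase ⟨hw, hwL⟩, ?_⟩
      rcases h.mem_chamber.1 hw with rfl | rfl | rfl
      · exact absurd rfl hwL
      · exact h.adj.1
      · exact h.adj.2.1

end Peaks

end A2Building

/-! ### Edges between peaks and the chamber above them. -/

namespace A2Building

/-- The arithmetic of an edge within one depth: `p`, `q`, `u` are the positions of a lattice, and
`x`, `y`, `z` say which jumps are removed. Positivity excludes the vertices of `C`, which are joined
to each other at depth 0. -/
theorem middle_of_sum_eq {p q u x y z : ℤ} (hpq : p < q) (hqu : q < u) (h1 : (q - p) % 3 ≠ 0)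
    (h2 : (u - p) % 3 ≠ 0) (h3 : (u - q) % 3 ≠ 0) (hx : x = 0 ∨ x = 1) (hy : y = 0 ∨ y = 1)
    (hz : z = 0 ∨ z = 1) (n1 : ¬ (x = 0 ∧ y = 0 ∧ z = 0)) (n2 : ¬ (x = 1 ∧ y = 1 ∧ z = 1))
    (hpos : 0 < (q - p).natAbs / 3 + (u - p).natAbs / 3 + (u - q).natAbs / 3)
    (hd : (q + 3 * y - (p + 3 * x)).natAbs / 3 + (u + 3 * z - (p + 3 * x)).natAbs / 3 +
      (u + 3 * z - (q + 3 * y)).natAbs / 3 =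
      (q - p).natAbs / 3 + (u - p).natAbs / 3 + (u - q).natAbs / 3) :
    x = 0 ∧ y = 1 ∧ z = 0 ∨ x = 1 ∧ y = 0 ∧ z = 1 := by
  obtain ⟨a, rfl⟩ := Int.lt.dest hpq
  obtain ⟨b, rfl⟩ := Int.lt.dest hqu
  rcases hx with rfl | rfl <;> rcases hy with rfl | rfl <;> rcases hz with rfl | rfl <;>
    simp at n1 n2 ⊢ <;> omega

section Summits

variable {O K : Type*} [CommRing O] [Field K] [Algebra O K] [FaithfulSMul O K] {π : O}
  {hπ : Irreducible π} [IsDomain O] [IsDiscreteValuationRing O] [IsFractionRing O K]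

/-- Two adjacent vertices of the same positive depth are represented by lattices one of which arises from
the other by removing the jump in the middle. -/
theorem exists_middle_of_adj {L : Lattice O K} {v : Vertex O K}
    (hadj : (graph K hπ).Adj (Vertex.mk L) v) (hd : depth hπ v = depth hπ (Vertex.mk L))
    (hpos : 0 < depth hπ (Vertex.mk L)) :
    ∃ (M : Lattice O K) (r s t : Fin 3), Vertex.mk M = v ∧ M.1 ≤ L.1 ∧ (shift hπ 1 L).1 ≤ M.1 ∧
      r ≠ s ∧ t ≠ r ∧ t ≠ s ∧ pos hπ L r < pos hπ L s ∧ pos hπ L s < pos hπ L t ∧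
      (coord hπ M r = coord hπ L r ∧ coord hπ M s = coord hπ L s + 1 ∧
          coord hπ M t = coord hπ L t ∨
        coord hπ M r = coord hπ L r + 1 ∧ coord hπ M s = coord hπ L s ∧
          coord hπ M t = coord hπ L t + 1) := by
  obtain ⟨M, rfl, hM1, hM2, hM3, hM4⟩ := (adj_mk_iff hπ).1 hadj
  obtain ⟨_, _, r, s, t, h, hr, hs, hrs, hst⟩ := exists_isFlag_ascending (hπ := hπ) L
  refine ⟨M, r, s, t, rfl, hM1, hM2, h.ne, hr, hs, hrs, hst, ?_⟩
  have hne := h.ne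
  have hall : ∀ i, i = r ∨ i = s ∨ i = t := by omega
  have n1 : ¬ (coord hπ M r = coord hπ L r ∧ coord hπ M s = coord hπ L s ∧
      coord hπ M t = coord hπ L t) := fun ⟨h1, h2, h3⟩ =>
    hM3 (eq_of_le_of_coord_eq hM1 fun i => by rcases hall i with rfl | rfl | rfl <;> assumption)
  have n2 : ¬ (coord hπ M r = coord hπ L r + 1 ∧ coord hπ M s = coord hπ L s + 1 ∧
      coord hπ M t = coord hπ L t + 1) := fun ⟨h1, h2, h3⟩ =>
    hM4 (eq_of_le_of_coord_eq (hπ := hπ) hM2 fun i => by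
      rw [coord_shift]; rcases hall i with rfl | rfl | rfl <;> omega).symm
  have a1 := coord_anti (hπ := hπ) hM1 r
  have a2 := coord_anti (hπ := hπ) hM1 s
  have a3 := coord_anti (hπ := hπ) hM1 t
  have b1 := coord_anti (hπ := hπ) hM2 r
  have b2 := coord_anti (hπ := hπ) hM2 s
  have b3 := coord_anti (hπ := hπ) hM2 t
  rw [coord_shift] at b1 b2 b3
  rw [depth_mk h.ne hr hs] at hd hpos
  rw [depth_mk h.ne hr hs] at hd
  have hp : ∀ i, pos hπ M i = pos hπ L i + 3 * (coord hπ M i - coord hπ L i) := fun i => by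
    rw [pos, pos]
    ring
  rw [hp, hp, hp] at hd
  have := middle_of_sum_eq hrs hst (by simp only [pos]; omega) (by simp only [pos]; omega)
    (by simp only [pos]; omega) (by omega) (by omega) (by omega) (by omega) (by omega) hpos hd
  omega

/-- The case of `existsUnique_chamber_of_adj` in which `M` arises from `L` by removing the middle
jump. -/
theorem existsUnique_of_middle {n : ℕ} (hn : 0 < n) {L M : Lattice O K} {r s t : Fin 3}
    (hM1 : M.1 ≤ L.1) (hM2 : (shift hπ 1 L).1 ≤ M.1) (hne : r ≠ s) (hr : t ≠ r) (hs : t ≠ s)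
    (hrs : pos hπ L r < pos hπ L s) (hst : pos hπ L s < pos hπ L t)
    (hMr : coord hπ M r = coord hπ L r) (hMs : coord hπ M s = coord hπ L s + 1)
    (hMt : coord hπ M t = coord hπ L t) (hL : depth hπ (Vertex.mk L) = n)
    {Du Dv : Building.Chamber (graph K hπ)}
    (hDu : Building.IsSummit (hyperspecialChamber K hπ) n (Vertex.mk L) Du)
    (hDv : Building.IsSummit (hyperspecialChamber K hπ) n (Vertex.mk M) Dv) :
    ∃! E : Building.Chamber (graph K hπ), (hyperspecialChamber K hπ).dist E = n + 1 ∧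
      Vertex.mk L ∈ E.verts ∧ Vertex.mk M ∈ E.verts ∧
      (Building.Chamber.graph _).Adj E Du ∧ (Building.Chamber.graph _).Adj E Dv := by
  have hall : ∀ i, i = r ∨ i = s ∨ i = t := by omega
  -- Restoring the top jump to `πL` inside `M` leaves a lattice with the lowest and middle jumps
  -- removed.
  obtain ⟨X, hX1, hX2, hX⟩ := exists_coord_eq (hπ := hπ) (r := t) hM2
    ((shift_one (hπ := hπ) M).ge.trans (shift_mono hM1 1)) (by rw [coord_shift, hMt])
  have hE : IsFlag hπ L M X s r := by
    refine ⟨hne.symm, hM1, hX2, hX1, fun i => ?_, fun i => ?_⟩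
    · rcases hall i with rfl | rfl | rfl
      · rw [if_neg hne, hMr]
      · rw [if_pos rfl, hMs]
      · rw [if_neg hs, hMt]
    · rw [hX, coord_shift]
      rcases hall i with rfl | rfl | rfl
      · rw [if_neg hr.symm, if_pos (Or.inr rfl)]
      · rw [if_neg hs.symm, if_pos (Or.inl rfl)]
      · rw [if_pos rfl, if_neg (by omega), hMt]
  have hlen : length hE.chamber = n + 1 := by
    rw [hE.length_chamber hs hr]
    rw [depth_mk hne hr hs] at hL
    simp only [pos] at *
    omega
  -- Being joined to both `[L]` and `[M]`, a vertex of this depth must lie in the base of either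
  -- summit, which gives the two adjacencies.
  have hXd : depth hπ (Vertex.mk X) ≤ n - 1 := by
    have h1 := hE.coord₂_cases
    have h2 := (hE.coord_third hs hr).2
    rw [depth_mk hne hr hs] at hL ⊢
    simp only [pos] at *
    omega
  have hdist := dist_hyperspecialChamber hE.chamber
  rw [hlen, Nat.cast_succ] at hdist
  have hLE : Vertex.mk L ∈ hE.chamber.verts := hE.mem_chamber.2 (Or.inl rfl)
  have hME : Vertex.mk M ∈ hE.chamber.verts := hE.mem_chamber.2 (Or.inr (Or.inl rfl))
  have hXE : Vertex.mk X ∈ hE.chamber.verts := hE.mem_chamber.2 (Or.inr (Or.inr rfl))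
  have hadj : ∀ {w D}, (graph K hπ).Adj w (Vertex.mk X) → w ∈ hE.chamber.verts →
      Building.IsSummit (hyperspecialChamber K hπ) n w D →
      (Building.Chamber.graph _).Adj hE.chamber D := by
    intro w D hw hwE hD
    have hXD : Vertex.mk X ∈ D.verts \ {w} := hD.neighbours ▸ ⟨mem_region_iff.2 hXd, hw⟩
    refine adj_of_mem_edge hw.ne (fun h => ?_) hwE hXE hD.mem hXD.1
    have := hD.dist_eq
    rw [← h, dist_hyperspecialChamber, Nat.cast_inj] at this
    omega
  refine ⟨hE.chamber, ⟨hdist, hLE, hME, hadj hE.adj.2.1 hLE hDu, hadj hE.adj.2.2 hME hDv⟩, ?_⟩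
  rintro E' ⟨hd, hLE', hME', -, -⟩
  obtain ⟨M', X', s', r', hE', rfl⟩ := exists_isFlag hLE'
  rw [dist_hyperspecialChamber, ← Nat.cast_succ, Nat.cast_inj] at hd
  obtain ⟨t', hs', hr'⟩ := exists_ne_and_ne s' r'
  have hne' := hE'.ne
  have hMM : M = M' := by
    rcases hE'.mem_chamber.1 hME' with h | h | h
    · exact absurd h.symm hE.adj.1.ne
    · exact eq_of_mk_eq hM1 hM2 hE.ne_shift₁ hE'.le₁ (hE'.le₃.trans hE'.le₂) hE'.ne_shift₁ h
    · have := eq_of_mk_eq hM1 hM2 hE.ne_shift₁ (hE'.le₂.trans hE'.le₁) hE'.le₃ hE'.ne_shift₂ h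
      have h1 := hE'.coord₂_cases
      rw [← this, hE.coord₁, hE.coord₁] at h1
      split_ifs at h1 <;> omega
  subst hMM
  have hss : s' = s := by
    have h1 := hE'.coord₁_cases.1
    rw [hE.coord₁] at h1
    split_ifs at h1 with h
    · exact h
    · omega
  subst hss
  have hrr : r' = r := by
    rcases hall r' with h | h | h
    · exact h
    · exact absurd h hne'.symm
    -- The order middle, top, lowest has two inversions, so the length would be `n + 2`. Adjacency
    -- to the summits is not needed for uniqueness.
    · obtain rfl : t' = r := by omega
      subst h
      rw [hE'.length_chamber hs' hr'] at hd
      rw [depth_mk hne hr hs] at hL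
      simp only [pos] at *
      omega
  subst hrr
  refine hE'.chamber_congr hE rfl
    (hE.eq_of_coord_eq₂ hs hr hst (hrs.trans hst) (hE'.le₂.trans hE'.le₁) hE'.le₃ fun i => ?_)
  rw [hE.coord₂, hE'.coord₂]

/-- Two adjacent vertices of depth `n` span a unique chamber of length `n + 1` adjacent to both
summits. -/
theorem existsUnique_chamber_of_adj {n : ℕ} (hn : 0 < n) {u v : Vertex O K}
    (hu : depth hπ u = n) (hv : depth hπ v = n) (hadj : (graph K hπ).Adj u v)
    {Du Dv : Building.Chamber (graph K hπ)}
    (hDu : Building.IsSummit (hyperspecialChamber K hπ) n u Du)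
    (hDv : Building.IsSummit (hyperspecialChamber K hπ) n v Dv) :
    ∃! E : Building.Chamber (graph K hπ), (hyperspecialChamber K hπ).dist E = n + 1 ∧
      u ∈ E.verts ∧ v ∈ E.verts ∧
      (Building.Chamber.graph _).Adj E Du ∧ (Building.Chamber.graph _).Adj E Dv := by
  obtain ⟨L, rfl⟩ := exists_mk_eq u
  obtain ⟨M, r, s, t, rfl, hM1, hM2, hne, hr, hs, hrs, hst, h | h⟩ :=
    exists_middle_of_adj hadj (hv.trans hu.symm) (hu ▸ hn)
  · exact existsUnique_of_middle hn hM1 hM2 hne hr hs hrs hst h.1 h.2.1 h.2.2 hu hDu hDv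
  -- If `M` removes the lowest and top jumps, then `πL` arises from `M` by removing the one at `s`.
  -- It is still the middle one: had the lowest jump overtaken it, the depth would have grown.
  · have key := existsUnique_of_middle (hπ := hπ) hn hM2 (shift_mono hM1 1) hne hr hs ?_ ?_
      (by rw [coord_shift, h.1]) (by rw [coord_shift, h.2.1]) (by rw [coord_shift, h.2.2]) hv hDv
      (by rwa [mk_shift])
    · rw [mk_shift] at key
      refine (existsUnique_congr fun E => ?_).1 key
      tauto
    · rw [depth_mk hne hr hs] at hu hv
      simp only [pos] at *
      omega
    · rw [depth_mk hne hr hs] at hu hv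
      simp only [pos] at *
      omega

end Summits

end A2Building

theorem mainTheorem3 (p : ℕ) [Fact p.Prime] (K : Type*) [Field K]
    [Algebra ℚ_[p] K] [FiniteDimensional ℚ_[p] K]
    [Algebra ℤ_[p] K] [IsScalarTower ℤ_[p] ℚ_[p] K]
    (π : integralClosure ℤ_[p] K) (hπ : Irreducible π)
    (C : Building.Chamber (A2Building.graph K hπ)) (hC : C = A2Building.hyperspecialChamber K hπ)
    (n : ℕ) (hn : 0 < n) :
    (∀ v ∈ Building.region C n \ Building.region C (n - 1), Building.IsPeak C n v) ∧
    (∀ u ∈ Building.region C n \ Building.region C (n - 1),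
      ∀ v ∈ Building.region C n \ Building.region C (n - 1),
      (A2Building.graph K hπ).Adj u v →
      ∀ Du Dv : Building.Chamber (A2Building.graph K hπ),
        Building.IsSummit C n u Du → Building.IsSummit C n v Dv →
        ∃! E : Building.Chamber (A2Building.graph K hπ),
          C.dist E = n + 1 ∧ u ∈ E.verts ∧ v ∈ E.verts ∧
          (Building.Chamber.graph _).Adj E Du ∧ (Building.Chamber.graph _).Adj E Dv) := by
  subst hC
  have := integralClosure_isDiscreteValuationRing p K hπ
  have : IsFractionRing (integralClosure ℤ_[p] K) K :=
    integralClosure.isFractionRing_of_finite_extension ℚ_[p] K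
  -- Since `0 < n`, the subtraction `n - 1` is genuine and the difference of regions is the set of
  -- vertices of depth exactly `n`.
  have hdepth : ∀ v ∈ Building.region (A2Building.hyperspecialChamber K hπ) n \
      Building.region (A2Building.hyperspecialChamber K hπ) (n - 1),
      A2Building.depth hπ v = n := by
    rintro v ⟨h1, h2⟩
    rw [A2Building.mem_region_iff] at h1 h2
    omega
  exact ⟨fun v hv => ⟨hv, A2Building.exists_isSummit hn (hdepth v hv)⟩,
    fun u hu v hv hadj Du Dv hDu hDv =>
      A2Building.existsUnique_chamber_of_adj hn (hdepth u hu) (hdepth v hv) hadj hDu hDv⟩
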